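/- **Notation.** For a field $K$, let $T(K^3)$ be the Tits building: the simplicial complex whose vertices are the subspaces $0\neq V\neq K^3$ and whose simplices are the flags. Let $\mathrm{St}(K^3)=\widetilde H_1(T(K^3);\mathbb Q)$ be the Steinberg module, with its natural left action of $\mathrm{GL}_3(K)$. For $x,y,z\in K^3$ the modular symbol $[x,y,z]\in \mathrm{St}(K^3)$ is the fundamental class of the hexagon whose vertices are the subspaces spanned by the proper nonempty subsets of $\{x,y,z\}$ if $x,y,z$ is a basis of $K^3$ (oriented compatibly with the action, $g[x,y,z]=[gx,gy,gz]$), and $[x,y,z]=0$ if $x,y,z$ are linearly dependent. Let $E$ be a real quadratic field and $\Gamma$ a subgroup of finite index in $\mathrm{SL}_3(\mathbb Z)$. The map $V\mapsto E\otimes V$ embeds $\mathrm{St}(\mathbb Q^3)$ into $\mathrm{St}(E^3)$. Let $C=\mathrm{St}(E^3)/\mathrm{St}(\mathbb Q^3)$, and let $H(\Gamma,E)$ be the image of the connecting homomorphism $H_1(\Gamma,C)\to H_0(\Gamma,\mathrm{St}(\mathbb Q^3))$ of the exact sequence $0\to \mathrm{St}(\mathbb Q^3)\to \mathrm{St}(E^3)\to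 C\to 0$. For $x,y,z\in\mathbb Q^3$ write $[x,y,z]_\Gamma$ for the class of $[x,y,z]\in\mathrm{St}(\mathbb Q^3)$ in $H_0(\Gamma,\mathrm{St}(\mathbb Q^3))=\mathrm{St}(\mathbb Q^3)_\Gamma$. A matrix $h\in \mathrm{GL}_2(\mathbb Z)$ is *unital* if it fixes the point $(\beta:1)\in\mathbb P^1(E)$ for some $\beta\in E\setminus\mathbb Q$. For $h$ unital and $u\in\mathbb Z^2$ put $$M(h,u)=\begin{bmatrix} h&u\\ 0&\epsilon\end{bmatrix}\in \mathrm{SL}_3(\mathbb Z),\qquad \epsilon=\det h=\pm1.$$ For nonzero $a\in\mathbb Z^3$ and $b\in E^3$ let $\mathrm{SL}_3(\mathbb Z)_{a,b}$ be the subgroup of $\mathrm{SL}_3(\mathbb Z)$ stabilizing both the line $\mathbb Q a$ and the line $E b$. Let $P_3$ be the stabilizer in $\mathrm{SL}_3(\mathbb Z)$ of the plane of vectors with third coordinate $0$, and let $e={}^t(1,0,0)$. Consider the symbols $[f,\gamma f,da]_\Gamma$ obtained by the following steps: 1. Choose a unital $h$ and $u\in\mathbb Z^2$. 2. Choose a basis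 $\{b,b',a\}$ of $E^3$ consisting of eigenvectors of $M(h,u)$, with $b\in E^3$, $b'$ the Galois conjugate of $b$, and $a\in\mathbb Z^3$ (if there is no such basis, $(h,u)$ contributes no symbol). 3. Choose $d\in\mathrm{SL}_3(\mathbb Z)$. 4. Let $\gamma$ be the smallest positive power of $dM(h,u)d^{-1}$ which lies in $\Gamma$. 5. Set $f=de$. **Theorem.** $H(\Gamma,E)$ is the $\mathbb Q$-span of all symbols $[f,\gamma f,da]_\Gamma$ arising from all possible choices in Steps 1–5. Moreover, it is still the $\mathbb Q$-span of the symbols so obtained if the choice of $d$ in Step 3 is restricted in either of the following ways: * for each $(a,b)$, to an arbitrarily chosen set $E(a,b)$ of representatives of the double cosets $\Gamma\backslash \mathrm{SL}_3(\mathbb Z)/\mathrm{SL}_3(\mathbb Z)_{a,b}$; * to an arbitrarily chosen set of representatives of the double cosets $\Gamma\backslash \mathrm{SL}_3(\mathbb Z)/P_3$. -/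

import Mathlib

open CategoryTheory
open scoped MatrixGroups

namespace RealQuadraticSteinberg

noncomputable section

/-! ## The Tits building of `K³` and the Steinberg module -/

/-- Vertices of the Tits building `T(K³)`: the proper nonzero subspaces of `K³`. -/
abbrev TitsVertex (K : Type*) [Field K] : Type _ :=
  {V : Submodule K (Fin 3 → K) // V ≠ ⊥ ∧ V ≠ ⊤}

/-- Edges of the Tits building `T(K³)`: flags `V < W` of proper nonzero subspaces. -/
abbrev TitsEdge (K : Type*) [Field K] : Type _ :=
  {p : TitsVertex K × TitsVertex K // p.1 < p.2}

/-- There is no flag of three proper nonzero subspaces of `K³`, so `T(K³)` has no simplices of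
dimension `≥ 2`. -/
theorem not_flag_three {K : Type*} [Field K] (U V W : TitsVertex K) : ¬ (U < V ∧ V < W) := by
  rintro ⟨h1, h2⟩
  have a := Submodule.finrank_lt_finrank_of_lt (show U.1 < V.1 from h1)
  have b := Submodule.finrank_lt_finrank_of_lt (show V.1 < W.1 from h2)
  have c := Submodule.finrank_lt W.2.2
  have d : 0 < Module.finrank K U.1 := by
    rw [Nat.pos_iff_ne_zero, Ne, Submodule.finrank_eq_zero]
    exact U.2.1
  simp only [Module.finrank_fin_fun] at c
  omega

/-- The simplicial boundary `C₁(T(K³); ℚ) → C₀(T(K³); ℚ)`, each edge `V < W` being oriented from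
`V` to `W`. -/
def boundary (K : Type*) [Field K] : (TitsEdge K →₀ ℚ) →ₗ[ℚ] (TitsVertex K →₀ ℚ) :=
  Finsupp.linearCombination ℚ fun e => Finsupp.single e.1.2 1 - Finsupp.single e.1.1 1

/-- The Steinberg module `St(K³) = H̃₁(T(K³); ℚ)`.  The building `T(K³)` has no `2`-simplices
(`not_flag_three`), so its first reduced homology is the space of `1`-cycles. -/
def Steinberg (K : Type*) [Field K] : Submodule ℚ (TitsEdge K →₀ ℚ) :=
  LinearMap.ker (boundary K)

section functoriality

variable {K L J : Type*} [Field K] [Field L] [Field J]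

/-- The map on edges induced by a strictly monotone map on vertices. -/
def edgeMap (φ : TitsVertex K → TitsVertex L) (hφ : StrictMono φ) (e : TitsEdge K) : TitsEdge L :=
  ⟨(φ e.1.1, φ e.1.2), hφ e.2⟩

theorem boundary_lmapDomain (φ : TitsVertex K → TitsVertex L) (hφ : StrictMono φ)
    (x : TitsEdge K →₀ ℚ) :
    boundary L (Finsupp.lmapDomain ℚ ℚ (edgeMap φ hφ) x) =
      Finsupp.lmapDomain ℚ ℚ φ (boundary K x) := by
  induction x using Finsupp.induction_linear with
  | zero => simp
  | add f g hf hg => simp only [map_add, hf, hg]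
  | single e r =>
    simp [boundary, Finsupp.lmapDomain_apply, Finsupp.mapDomain_single, edgeMap, smul_sub,
      map_sub]

/-- The map on Steinberg modules induced by a strictly monotone map of Tits buildings. -/
def steinbergMap (φ : TitsVertex K → TitsVertex L) (hφ : StrictMono φ) :
    Steinberg K →ₗ[ℚ] Steinberg L :=
  (Finsupp.lmapDomain ℚ ℚ (edgeMap φ hφ)).restrict (by
    intro x hx
    rw [Steinberg, LinearMap.mem_ker] at hx ⊢
    rw [boundary_lmapDomain, hx, map_zero])

theorem steinbergMap_coe (φ : TitsVertex K → TitsVertex L) (hφ : StrictMono φ)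
    (x : Steinberg K) :
    (steinbergMap φ hφ x : TitsEdge L →₀ ℚ) = Finsupp.mapDomain (edgeMap φ hφ) x.1 := rfl

theorem steinbergMap_steinbergMap (φ : TitsVertex K → TitsVertex L) (hφ : StrictMono φ)
    (ψ : TitsVertex L → TitsVertex J) (hψ : StrictMono ψ) (x : Steinberg K) :
    steinbergMap ψ hψ (steinbergMap φ hφ x) = steinbergMap (ψ ∘ φ) (hψ.comp hφ) x := by
  apply Subtype.ext
  rw [steinbergMap_coe, steinbergMap_coe, steinbergMap_coe, ← Finsupp.mapDomain_comp]
  rfl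

theorem steinbergMap_congr {φ ψ : TitsVertex K → TitsVertex L} (hφ : StrictMono φ)
    (hψ : StrictMono ψ) (h : ∀ V, φ V = ψ V) : steinbergMap φ hφ = steinbergMap ψ hψ := by
  obtain rfl : φ = ψ := funext h
  rfl

theorem steinbergMap_injective (φ : TitsVertex K → TitsVertex L) (hφ : StrictMono φ)
    (hinj : Function.Injective φ) : Function.Injective (steinbergMap φ hφ) := by
  intro x y hxy
  apply Subtype.ext
  have h := congrArg Subtype.val hxy
  rw [steinbergMap_coe, steinbergMap_coe] at h
  refine Finsupp.mapDomain_injective ?_ h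
  intro e e' he
  have h1 := congrArg (fun t : TitsEdge L => t.1.1) he
  have h2 := congrArg (fun t : TitsEdge L => t.1.2) he
  exact Subtype.ext (Prod.ext (hinj h1) (hinj h2))

end functoriality

/-! ## The action of `GL₃(K)` -/

section action

variable {K : Type*} [Field K]

theorem mulVecLin_injective (g : GL (Fin 3) K) :
    Function.Injective (Matrix.mulVecLin (g : Matrix (Fin 3) (Fin 3) K)) :=
  Matrix.mulVec_injective_of_isUnit g.isUnit

/-- `g ∈ GL₃(K)` sends the subspace `V` to `gV`. -/
def vertexAct (g : GL (Fin 3) K) (V : TitsVertex K) : TitsVertex K :=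
  ⟨V.1.map (Matrix.mulVecLin (g : Matrix (Fin 3) (Fin 3) K)), by
    constructor
    · intro h
      apply V.2.1
      rw [← Submodule.comap_map_eq_of_injective (mulVecLin_injective g) V.1, h,
        Submodule.comap_bot, LinearMap.ker_eq_bot.2 (mulVecLin_injective g)]
    · intro h
      apply V.2.2
      rw [← Submodule.comap_map_eq_of_injective (mulVecLin_injective g) V.1, h,
        Submodule.comap_top]⟩

theorem vertexAct_strictMono (g : GL (Fin 3) K) : StrictMono (vertexAct g) := by
  intro V W h
  exact Submodule.map_strictMono_of_injective (mulVecLin_injective g) h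

theorem vertexAct_one (V : TitsVertex K) : vertexAct 1 V = V := by
  apply Subtype.ext
  simp [vertexAct]

theorem vertexAct_mul (g h : GL (Fin 3) K) (V : TitsVertex K) :
    vertexAct (g * h) V = vertexAct g (vertexAct h V) := by
  apply Subtype.ext
  simp only [vertexAct, Units.val_mul, Matrix.mulVecLin_mul, Submodule.map_comp]

variable (K) in
/-- The natural left action of `GL₃(K)` on `St(K³)`. -/
def steinbergRep : Representation ℚ (GL (Fin 3) K) (Steinberg K) where
  toFun g := steinbergMap (vertexAct g) (vertexAct_strictMono g)
  map_one' := by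
    rw [steinbergMap_congr (vertexAct_strictMono 1) strictMono_id vertexAct_one]
    ext1 x
    apply Subtype.ext
    rw [steinbergMap_coe]
    exact Finsupp.mapDomain_id
  map_mul' g h := by
    ext1 x
    rw [Module.End.mul_apply, steinbergMap_steinbergMap]
    exact congrArg (· x) (steinbergMap_congr _ _ (vertexAct_mul g h))

variable (K) in
/-- The natural homomorphism `SL₃(ℤ) → GL₃(K)`. -/
def toGLK : SL(3, ℤ) →* GL (Fin 3) K :=
  Matrix.SpecialLinearGroup.toGL.comp (Matrix.SpecialLinearGroup.map (Int.castRingHom K))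

variable (K) in
/-- `St(K³)` as a representation of a subgroup `Γ` of `SL₃(ℤ)`. -/
def steinbergRepOn (Γ : Subgroup SL(3, ℤ)) : Representation ℚ Γ (Steinberg K) :=
  (steinbergRep K).comp ((toGLK K).comp Γ.subtype)

end action

/-! ## Modular symbols -/

section modularSymbol

variable {K : Type*} [Field K]

theorem span_image_lt {v : Fin 3 → Fin 3 → K} (hv : LinearIndependent K v) {S T : Set (Fin 3)}
    (h : S ⊂ T) : Submodule.span K (v '' S) < Submodule.span K (v '' T) := by
  refine lt_of_le_of_ne (Submodule.span_mono (Set.image_mono h.1)) ?_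
  intro he
  obtain ⟨t, htT, htS⟩ := Set.exists_of_ssubset h
  apply hv.notMem_span_image htS
  rw [he]
  exact Submodule.subset_span (Set.mem_image_of_mem v htT)

/-- The vertex of `T(K³)` spanned by the members of a basis `v` indexed by a proper nonempty
subset `S`. -/
def spanVertex (v : Fin 3 → Fin 3 → K) (hv : LinearIndependent K v) (S : Set (Fin 3))
    (h0 : ∅ ⊂ S) (h1 : S ⊂ Set.univ) : TitsVertex K :=
  ⟨Submodule.span K (v '' S), by
    constructor
    · have := span_image_lt hv h0
      rw [Set.image_empty, Submodule.span_empty] at this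
      exact this.ne'
    · exact ((span_image_lt hv h1).trans_le le_top).ne⟩

theorem empty_ssubset_one (s : Equiv.Perm (Fin 3)) : (∅ : Set (Fin 3)) ⊂ {s 0} :=
  Set.empty_ssubset.2 ⟨s 0, rfl⟩

theorem one_ssubset_two (s : Equiv.Perm (Fin 3)) : ({s 0} : Set (Fin 3)) ⊂ {s 0, s 1} := by
  refine Set.ssubset_iff_of_subset (by simp) |>.2 ⟨s 1, by simp, ?_⟩
  simp

theorem two_ssubset_univ (s : Equiv.Perm (Fin 3)) :
    ({s 0, s 1} : Set (Fin 3)) ⊂ Set.univ := by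
  refine Set.ssubset_iff_of_subset (Set.subset_univ _) |>.2 ⟨s 2, by simp, ?_⟩
  simp

/-- The edge `⟨v_{s(0)}⟩ < ⟨v_{s(0)}, v_{s(1)}⟩` of the apartment of the basis `v`. -/
def apartmentEdge (v : Fin 3 → Fin 3 → K) (hv : LinearIndependent K v) (s : Equiv.Perm (Fin 3)) :
    TitsEdge K :=
  ⟨(spanVertex v hv {s 0} (empty_ssubset_one s) ((one_ssubset_two s).trans (two_ssubset_univ s)),
    spanVertex v hv {s 0, s 1} ((empty_ssubset_one s).trans (one_ssubset_two s))
      (two_ssubset_univ s)), span_image_lt hv (one_ssubset_two s)⟩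

theorem sum_sign_smul_eq_zero {X : Type*} [AddCommGroup X] [Module ℚ X]
    (F : Equiv.Perm (Fin 3) → X) (i j : Fin 3) (hij : i ≠ j)
    (hF : ∀ s, F (s * Equiv.swap i j) = F s) :
    ∑ s : Equiv.Perm (Fin 3), ((Equiv.Perm.sign s : ℤ) : ℚ) • F s = 0 := by
  have h : ∑ s : Equiv.Perm (Fin 3), ((Equiv.Perm.sign s : ℤ) : ℚ) • F s =
      -∑ s : Equiv.Perm (Fin 3), ((Equiv.Perm.sign s : ℤ) : ℚ) • F s := by
    rw [← Finset.sum_neg_distrib]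
    refine Fintype.sum_equiv (Equiv.mulRight (Equiv.swap i j)) _ _ fun s => ?_
    simp [hF, Equiv.Perm.sign_mul, Equiv.Perm.sign_swap hij]
  have h2 : (2 : ℚ) • ∑ s : Equiv.Perm (Fin 3), ((Equiv.Perm.sign s : ℤ) : ℚ) • F s = 0 := by
    rw [two_smul]
    nth_rewrite 1 [h]
    exact neg_add_cancel _
  exact (smul_eq_zero.1 h2).resolve_left two_ne_zero

/-- The oriented sum of the six edges of the apartment of the basis `v`. -/
def apartmentChain (v : Fin 3 → Fin 3 → K) (hv : LinearIndependent K v) : TitsEdge K →₀ ℚ :=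
  ∑ s : Equiv.Perm (Fin 3),
    ((Equiv.Perm.sign s : ℤ) : ℚ) • Finsupp.single (apartmentEdge v hv s) 1

theorem apartmentChain_mem (v : Fin 3 → Fin 3 → K) (hv : LinearIndependent K v) :
    apartmentChain v hv ∈ Steinberg K := by
  rw [Steinberg, LinearMap.mem_ker, apartmentChain, map_sum]
  simp only [map_smul, boundary, Finsupp.linearCombination_single, one_smul, smul_sub,
    Finset.sum_sub_distrib]
  rw [sum_sign_smul_eq_zero (fun s => Finsupp.single (apartmentEdge v hv s).1.2 (1 : ℚ)) 0 1
      (by decide), sum_sign_smul_eq_zero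
      (fun s => Finsupp.single (apartmentEdge v hv s).1.1 (1 : ℚ)) 1 2 (by decide), sub_zero]
  · intro s
    have : (apartmentEdge v hv (s * Equiv.swap 1 2)).1.1 = (apartmentEdge v hv s).1.1 := by
      apply Subtype.ext
      simp [apartmentEdge, spanVertex, Equiv.swap_apply_of_ne_of_ne]
    rw [this]
  · intro s
    have : (apartmentEdge v hv (s * Equiv.swap 0 1)).1.2 = (apartmentEdge v hv s).1.2 := by
      apply Subtype.ext
      simp [apartmentEdge, spanVertex, Set.pair_comm]
    rw [this]

open Classical in
/-- The modular symbol `[x, y, z] ∈ St(K³)`: the fundamental class of the apartment of the basis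
`x, y, z` of `K³`, and `0` if `x, y, z` are linearly dependent. -/
def modularSymbol (x y z : Fin 3 → K) : Steinberg K :=
  if hv : LinearIndependent K ![x, y, z] then
    ⟨apartmentChain ![x, y, z] hv, apartmentChain_mem _ hv⟩
  else 0

end modularSymbol

/-! ## The inclusion `St(ℚ³) ⊂ St(E³)` and the quotient `C = St(E³)/St(ℚ³)` -/

section extension

variable (E : Type*) [Field E] [CharZero E]

/-- The inclusion `ℚ³ ⊂ E³`. -/
def incl (v : Fin 3 → ℚ) : Fin 3 → E := fun i => (v i : E)

/-- The `E`-span in `E³` of a subspace `V` of `ℚ³`. -/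
def extend (V : Submodule ℚ (Fin 3 → ℚ)) : Submodule E (Fin 3 → E) :=
  Submodule.span E (incl E '' (V : Set (Fin 3 → ℚ)))

theorem incl_mem_extend_iff (V : Submodule ℚ (Fin 3 → ℚ)) (x : Fin 3 → ℚ) :
    incl E x ∈ extend E V ↔ x ∈ V := by
  constructor
  · intro hx
    by_contra hxV
    obtain ⟨f, hf, hV⟩ := Submodule.exists_le_ker_of_notMem hxV
    let F : (Fin 3 → E) →ₗ[E] E :=
      ∑ i, ((f (Pi.single i 1) : ℚ) : E) • LinearMap.proj i
    have hF : ∀ y, F (incl E y) = ((f y : ℚ) : E) := by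
      intro y
      rw [LinearMap.pi_apply_eq_sum_univ f y]
      simp only [F, incl, LinearMap.sum_apply, LinearMap.smul_apply, LinearMap.proj_apply,
        smul_eq_mul, Rat.cast_sum, Rat.cast_mul]
      refine Finset.sum_congr rfl fun i _ => ?_
      rw [mul_comm]
      congr 3
      ext j
      simp [Pi.single_apply, eq_comm]
    have hle : extend E V ≤ LinearMap.ker F := by
      rw [extend, Submodule.span_le]
      rintro _ ⟨y, hy, rfl⟩
      have := hV hy
      rw [LinearMap.mem_ker] at this
      simp [hF, this]
    have h0 := hle hx
    rw [LinearMap.mem_ker, hF] at h0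
    exact hf (by exact_mod_cast h0)
  · intro hx
    exact Submodule.subset_span ⟨x, hx, rfl⟩

/-- The map of Tits buildings `T(ℚ³) → T(E³)`, `V ↦ E ⊗ V`. -/
def extendVertex (V : TitsVertex ℚ) : TitsVertex E :=
  ⟨extend E V.1, by
    constructor
    · intro h
      obtain ⟨x, hx, hx0⟩ := Submodule.exists_mem_ne_zero_of_ne_bot V.2.1
      have := (incl_mem_extend_iff E V.1 x).2 hx
      rw [h, Submodule.mem_bot] at this
      apply hx0
      ext i
      have := congrFun this i
      simpa [incl] using this
    · intro h
      apply V.2.2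
      rw [eq_top_iff]
      intro x _
      rw [← incl_mem_extend_iff E, h]
      trivial⟩

theorem extendVertex_injective : Function.Injective (extendVertex E) := by
  intro V W h
  have h' : extend E V.1 = extend E W.1 := congrArg Subtype.val h
  apply Subtype.ext
  ext x
  rw [← incl_mem_extend_iff E, h', incl_mem_extend_iff]

theorem extendVertex_strictMono : StrictMono (extendVertex E) := by
  refine Monotone.strictMono_of_injective ?_ (extendVertex_injective E)
  intro V W h
  exact Submodule.span_mono (Set.image_mono h)

/-- The inclusion `St(ℚ³) → St(E³)`. -/
def steinbergIncl : Steinberg ℚ →ₗ[ℚ] Steinberg E :=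
  steinbergMap (extendVertex E) (extendVertex_strictMono E)

theorem steinbergIncl_injective : Function.Injective (steinbergIncl E) :=
  steinbergMap_injective _ _ (extendVertex_injective E)

theorem toGLK_mulVec_incl (g : SL(3, ℤ)) (x : Fin 3 → ℚ) :
    (toGLK E g : Matrix (Fin 3) (Fin 3) E).mulVec (incl E x) =
      incl E ((toGLK ℚ g : Matrix (Fin 3) (Fin 3) ℚ).mulVec x) := by
  ext i
  simp [toGLK, incl, Matrix.mulVec, dotProduct, Fin.sum_univ_three]

theorem extendVertex_vertexAct (g : SL(3, ℤ)) (V : TitsVertex ℚ) :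
    extendVertex E (vertexAct (toGLK ℚ g) V) = vertexAct (toGLK E g) (extendVertex E V) := by
  apply Subtype.ext
  simp only [extendVertex, vertexAct, extend]
  rw [Submodule.map_span, Submodule.map_coe, ← Set.image_comp, ← Set.image_comp]
  congr 1
  refine Set.image_congr fun x _ => ?_
  exact (toGLK_mulVec_incl E g x).symm

theorem steinbergIncl_comm (Γ : Subgroup SL(3, ℤ)) (g : Γ) (x : Steinberg ℚ) :
    steinbergIncl E (steinbergRepOn ℚ Γ g x) = steinbergRepOn E Γ g (steinbergIncl E x) := by
  change steinbergMap _ (extendVertex_strictMono E)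
      (steinbergMap _ (vertexAct_strictMono (toGLK ℚ g)) x) =
    steinbergMap _ (vertexAct_strictMono (toGLK E g))
      (steinbergMap _ (extendVertex_strictMono E) x)
  rw [steinbergMap_steinbergMap, steinbergMap_steinbergMap]
  exact congrArg (· x) (steinbergMap_congr _ _ (extendVertex_vertexAct E g))

/-- The quotient representation `C = St(E³)/St(ℚ³)` of `Γ`. -/
def quotientRep (Γ : Subgroup SL(3, ℤ)) :
    Representation ℚ Γ (Steinberg E ⧸ LinearMap.range (steinbergIncl E)) :=
  (steinbergRepOn E Γ).quotient (LinearMap.range (steinbergIncl E)) (by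
    rintro g _ ⟨x, rfl⟩
    exact ⟨steinbergRepOn ℚ Γ g x, steinbergIncl_comm E Γ g x⟩)

end extension

section homology

variable (Γ : Subgroup SL(3, ℤ)) (E : Type) [Field E] [CharZero E]

/-- `0 → St(ℚ³) → St(E³) → C → 0` as a short complex of representations of `Γ`. -/
def steinbergSequence : ShortComplex (Rep ℚ Γ) where
  X₁ := Rep.of (steinbergRepOn ℚ Γ)
  X₂ := Rep.of (steinbergRepOn E Γ)
  X₃ := Rep.of (quotientRep E Γ)
  f := Rep.ofHom ⟨steinbergIncl E, fun g => LinearMap.ext (steinbergIncl_comm E Γ g)⟩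
  g := Rep.ofHom ⟨(LinearMap.range (steinbergIncl E)).mkQ, fun _ => rfl⟩
  zero := by
    ext x
    exact (Submodule.Quotient.mk_eq_zero _).2 ⟨x, rfl⟩

theorem steinbergSequence_shortExact : (steinbergSequence Γ E).ShortExact where
  exact := by
    rw [← ShortComplex.exact_map_iff_of_faithful _ (forget₂ (Rep ℚ Γ) (ModuleCat ℚ)),
      ShortComplex.moduleCat_exact_iff]
    intro x hx
    exact (Submodule.Quotient.mk_eq_zero (LinearMap.range (steinbergIncl E))).1 hx
  mono_f := (Rep.mono_iff_injective _).2 (steinbergIncl_injective E)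
  epi_g := (Rep.epi_iff_surjective _).2 (Submodule.mkQ_surjective _)

/-- `H₀(Γ, St(ℚ³))`. -/
abbrev SteinbergH0 : Type := groupHomology (Rep.of (steinbergRepOn ℚ Γ)) 0

/-- `H(Γ, E)`: the image of the connecting homomorphism
`H₁(Γ, St(E³)/St(ℚ³)) → H₀(Γ, St(ℚ³))`. -/
def HSpace : Submodule ℚ (SteinbergH0 Γ) :=
  LinearMap.range (groupHomology.δ (steinbergSequence_shortExact Γ E) 1 0 rfl).hom

/-- `[x, y, z]_Γ`: the class of `[x, y, z] ∈ St(ℚ³)` in `H₀(Γ, St(ℚ³)) = St(ℚ³)_Γ`. -/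
def symbolClass (x y z : Fin 3 → ℚ) : SteinbergH0 Γ :=
  groupHomology.H0π (Rep.of (steinbergRepOn ℚ Γ)) (modularSymbol x y z)

end homology

/-! ## Unital matrices and the construction of the symbols -/

/-- `h ∈ GL₂(ℤ)` is `β`-unital: it fixes the point `(β : 1)` of `ℙ¹(E)`. -/
def IsUnitalFor {E : Type*} [Field E] (β : E) (h : GL (Fin 2) ℤ) : Prop :=
  ∃ c : Eˣ, ((h : Matrix (Fin 2) (Fin 2) ℤ).map (Int.cast : ℤ → E)).mulVec ![β, 1] =
    (c : E) • ![β, 1]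

/-- `h ∈ GL₂(ℤ)` is unital with respect to `E`: it is `β`-unital for some `β ∈ E ∖ ℚ`. -/
def IsUnital (E : Type*) [Field E] [CharZero E] (h : GL (Fin 2) ℤ) : Prop :=
  ∃ β : E, β ∉ Set.range (Rat.cast : ℚ → E) ∧ IsUnitalFor β h

/-- `M(h, u)`, the block matrix with rows `(h, u)` and `(0, ε)`, where `ε = det h = ±1`. -/
def blockMatrix (h : GL (Fin 2) ℤ) (u : Fin 2 → ℤ) : SL(3, ℤ) :=
  ⟨!![h.1 0 0, h.1 0 1, u 0;
      h.1 1 0, h.1 1 1, u 1;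
      0, 0, h.1.det], by
    have hu : h.1.det * h.1.det = 1 := Int.isUnit_mul_self (Matrix.isUnits_det_units h)
    rw [Matrix.det_fin_three]
    rw [Matrix.det_fin_two] at hu ⊢
    simp
    linear_combination hu⟩

/-- The vector `a ∈ ℤ³` regarded as a vector in `K³`. -/
def intVec (K : Type*) [Field K] (a : Fin 3 → ℤ) : Fin 3 → K := fun i => (a i : K)

/-- `v ∈ K³` satisfies `g v = c v` for some `c ∈ K`. -/
def IsEigen {K : Type*} [Field K] (g : SL(3, ℤ)) (v : Fin 3 → K) : Prop :=
  ∃ c : K, (toGLK K g : Matrix (Fin 3) (Fin 3) K).mulVec v = c • v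

/-- `{b, b', a}` is a basis of `E³` consisting of eigenvectors of `g`, where `b'` is the Galois
conjugate of `b ∈ E³` and `a ∈ ℤ³`. -/
def IsConjEigenbasis {E : Type*} [Field E] [CharZero E] (g : SL(3, ℤ)) (a : Fin 3 → ℤ)
    (b : Fin 3 → E) : Prop :=
  ∃ σ : E ≃ₐ[ℚ] E, σ ≠ 1 ∧ LinearIndependent E ![b, fun i => σ (b i), intVec E a] ∧
    IsEigen g b ∧ IsEigen g (fun i => σ (b i)) ∧ IsEigen g (intVec E a)

/-- The stabilizer in `SL₃(ℤ)` of a subspace of `K³`. -/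
def subspaceStabilizer {K : Type*} [Field K] (W : Submodule K (Fin 3 → K)) :
    Subgroup SL(3, ℤ) where
  carrier := {g | W.map (Matrix.mulVecLin (toGLK K g : Matrix (Fin 3) (Fin 3) K)) = W}
  one_mem' := by simp
  mul_mem' := by
    intro g h hg hh
    simp only [Set.mem_ofPred_eq] at hg hh ⊢
    rw [map_mul, Units.val_mul, Matrix.mulVecLin_mul, Submodule.map_comp, hh, hg]
  inv_mem' := by
    intro g hg
    simp only [Set.mem_ofPred_eq] at hg ⊢
    nth_rewrite 1 [← hg]
    rw [← Submodule.map_comp, ← Matrix.mulVecLin_mul, ← Units.val_mul, ← map_mul]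
    simp

/-- `SL₃(ℤ)_{a,b}`: the stabilizer in `SL₃(ℤ)` of the points `â ∈ ℙ²(ℚ)` and `b̂ ∈ ℙ²(E)`. -/
def pairStabilizer {E : Type*} [Field E] (a : Fin 3 → ℤ) (b : Fin 3 → E) : Subgroup SL(3, ℤ) :=
  subspaceStabilizer (Submodule.span ℚ {intVec ℚ a}) ⊓ subspaceStabilizer (Submodule.span E {b})

/-- `P₃`: the stabilizer in `SL₃(ℤ)` of the plane of vectors whose third coordinate is `0`. -/
def P3 : Subgroup SL(3, ℤ) :=
  subspaceStabilizer (LinearMap.ker (LinearMap.proj 2 : (Fin 3 → ℚ) →ₗ[ℚ] ℚ))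

/-- `R` is a set of representatives of the double cosets `Γ \ SL₃(ℤ) / S`: every double coset
contains exactly one element of `R`. -/
def IsDoubleCosetReps (Γ S : Subgroup SL(3, ℤ)) (R : Set SL(3, ℤ)) : Prop :=
  ∀ g : SL(3, ℤ), ∃! d : SL(3, ℤ), d ∈ R ∧ g ∈ DoubleCoset.doubleCoset d (Γ : Set SL(3, ℤ)) S

/-- The set of all `[f, γf, da]_Γ` obtained as follows: choose `h` unital and `u ∈ ℤ²`, put
`M = M(h, u)`; choose an eigenbasis `{b, b', a}` of `M` with `b'` the Galois conjugate of `b` and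
`a ∈ ℤ³`; choose `d ∈ D(a, b)`; let `γ` be the smallest positive power of `d M d⁻¹` lying in `Γ`,
and let `f = d e` with `e = (1, 0, 0)ᵗ`. -/
def outputs (Γ : Subgroup SL(3, ℤ)) (E : Type) [Field E] [CharZero E]
    (D : (Fin 3 → ℤ) → (Fin 3 → E) → Set SL(3, ℤ)) : Set (SteinbergH0 Γ) :=
  {m | ∃ (h : GL (Fin 2) ℤ) (u : Fin 2 → ℤ) (a : Fin 3 → ℤ) (b : Fin 3 → E) (d γ : SL(3, ℤ))
      (k : ℕ) (f : Fin 3 → ℤ),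
    IsUnital E h ∧ IsConjEigenbasis (blockMatrix h u) a b ∧ d ∈ D a b ∧
    IsLeast {j : ℕ | 0 < j ∧ (d * blockMatrix h u * d⁻¹) ^ j ∈ Γ} k ∧
    γ = (d * blockMatrix h u * d⁻¹) ^ k ∧
    f = d.1.mulVec ![1, 0, 0] ∧
    m = symbolClass Γ (intVec ℚ f) (intVec ℚ (γ.1.mulVec f)) (intVec ℚ (d.1.mulVec a))}

end

end RealQuadraticSteinberg

/-! By the long exact sequence, `HSpace Γ E` is the kernel of the map from the `Γ`-coinvariants of
St(ℚ³) to those of St(E³) (`H0π_mem_HSpace_iff`). The proof makes the quotient C explicit. Let X be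
the set of edges of T(E³) with both vertices irrational, and restrict cycles to X. An irrational
point lies in at most one rational plane and an irrational plane contains at most one rational
point. Hence a cycle vanishing on X has no edge with just one irrational vertex either, so it is
rational (`ker_irrationalPart`), and C embeds in ℚ[X].

Since E is quadratic, an irrational point b = v + βw lies in the rational plane spanned by v and w,
and dually an irrational plane contains a rational point. So an edge in X is ⟨b⟩ < ⟨b, a⟩ with a
integral, and after a translation by SL₃(ℤ), b = (β, 1, 0) (`exists_frame`). If f is a rational
vector of the rational plane P through b, the apartment [f, b, a] meets X in this edge alone
(`irrationalPart_modularSymbol`). Thus C ≅ ℚ[X] is a permutation module, with explicit lifts of its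
basis. An element γ of the stabilizer of the edge fixes P, a and b, and γ[f, b, a] - [f, b, a] =
-[f, γf, a] (`steinbergRep_sub_eq`). By a Shapiro-type argument, carried out by hand in
`mem_of_mem_coinvariants_ker`, these symbols span the kernel.

It remains to match them with the procedure. Conjugating γ by d gives a matrix preserving the
standard plane, hence some M(h, u), and its first power lying in Γ is γ itself
(`symbolClass_mem_outputs`). Conversely, an output with b in the standard plane is a coboundary in
St(E³), and for any other b the symbol degenerates to 0 (`outputs_subset_HSpace`). A restriction on
d is harmless as soon as the allowed edges meet every `Γ`-orbit on X (`MeetsOrbits`). -/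

namespace RealQuadraticSteinberg

noncomputable section

/-! ### Coinvariants and extensions by a permutation module -/

section abstract_coinvariants

variable {G M N X : Type*} [Group G] [AddCommGroup M] [Module ℚ M] [AddCommGroup N] [Module ℚ N]
  [MulAction G X]

/-- Let `0 → N → M → ℚ[X]` be an exact sequence of representations of `G`, and let `T` be a
`G`-stable submodule of `N` on whose quotient `G` acts trivially.  If every orbit of `G` on `X`
contains a point `x` lifting to some `m ∈ M` with `γ m - m ∈ T` for all `γ` in the stabilizer
of `x`, then every element of `N` which vanishes in the coinvariants of `M` lies in `T`. -/
theorem mem_of_mem_coinvariants_ker (ρM : Representation ℚ G M) (ρN : Representation ℚ G N)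
    (i : N →ₗ[ℚ] M) (hi : Function.Injective i) (hiρ : ∀ g n, i (ρN g n) = ρM g (i n))
    (π : M →ₗ[ℚ] (X →₀ ℚ)) (hπ : LinearMap.ker π = LinearMap.range i)
    (hπρ : ∀ g m, π (ρM g m) = Finsupp.mapDomain (g • ·) (π m))
    (T : Submodule ℚ N) (hT : ∀ g n, ρN g n - n ∈ T)
    (hlift : ∀ x : X, ∃ g : G, ∃ m : M, π m = Finsupp.single (g • x) 1 ∧
      ∀ γ : G, γ • g • x = g • x → ∃ t ∈ T, i t = ρM γ m - m)
    (z : N) (hz : i z ∈ Representation.Coinvariants.ker ρM) : z ∈ T := by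
  classical
  have hTρ : ∀ g, ∀ t ∈ T, ρN g t ∈ T := fun g t ht => by
    simpa using T.add_mem (hT g t) ht
  -- A lift with the required property can be transported along an orbit, because `T` is stable; so
  -- every point of `X` has one.
  have hlift' : ∀ x : X, ∃ m : M, π m = Finsupp.single x 1 ∧
      ∀ γ : G, γ • x = x → ∃ t ∈ T, i t = ρM γ m - m := by
    intro x
    obtain ⟨g, m, hm, h⟩ := hlift x
    refine ⟨ρM g⁻¹ m, by simp [hπρ, hm, Finsupp.mapDomain_single], fun γ hγ => ?_⟩
    obtain ⟨t, ht, hit⟩ := h (g * γ * g⁻¹) (by simp [mul_smul, hγ])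
    refine ⟨ρN g⁻¹ t, hTρ _ _ ht, ?_⟩
    rw [hiρ, hit, map_sub, ← Module.End.mul_apply, ← map_mul, ← Module.End.mul_apply, ← map_mul]
    simp [mul_assoc]
  choose m hm hstab using hlift'
  let r : X → X := fun x => (Quotient.mk (MulAction.orbitRel G X) x).out
  have hr : ∀ x, ∃ g : G, g • r x = x := fun x =>
    (MulAction.orbitRel G X).symm (Quotient.mk_out (s := MulAction.orbitRel G X) x)
  have hrg : ∀ (g : G) x, r (g • x) = r x := fun g x => by
    have : (Quotient.mk (MulAction.orbitRel G X) (g • x)) = Quotient.mk _ x :=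
      Quotient.sound ⟨g, rfl⟩
    simp only [r, this]
  choose t ht using hr
  let s : (X →₀ ℚ) →ₗ[ℚ] M := Finsupp.linearCombination ℚ fun x => ρM (t x) (m (r x))
  have hs1 : ∀ x, s (Finsupp.single x 1) = ρM (t x) (m (r x)) := fun x => by simp [s]
  have hπs : ∀ w, π (s w) = w := by
    intro w
    have : π ∘ₗ s = LinearMap.id := by
      ext1 x
      ext1
      simp [hs1, hπρ, hm, Finsupp.mapDomain_single, ht]
    exact LinearMap.congr_fun this w
  -- The section is equivariant modulo `T`: its defect at `x` is a translate of the coboundary of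
  -- the lift at the stabilizer element `(t (g • x))⁻¹ * g * t x`.
  have hsg : ∀ (g : G) (w : X →₀ ℚ),
      ρM g (s w) - s (Finsupp.mapDomain (g • ·) w) ∈ T.map i := by
    intro g w
    induction w using Finsupp.induction_linear with
    | zero => simp
    | add f h hf hh =>
      simp only [map_add, Finsupp.mapDomain_add]
      rw [add_sub_add_comm]
      exact add_mem hf hh
    | single x c =>
      have : Finsupp.single x c = c • Finsupp.single x (1 : ℚ) := by simp
      rw [this, map_smul, Finsupp.mapDomain_smul, map_smul, map_smul, ← smul_sub]
      refine Submodule.smul_mem _ _ ?_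
      rw [Finsupp.mapDomain_single, hs1, hs1, hrg]
      obtain ⟨y, hy, hiy⟩ := hstab (r x) ((t (g • x))⁻¹ * g * t x) (by
        rw [mul_smul, mul_smul, ht, inv_smul_eq_iff]
        conv_rhs => rw [← hrg g x]
        exact (ht _).symm)
      refine ⟨ρN (t (g • x)) y, hTρ _ _ hy, ?_⟩
      rw [hiρ, hiy, map_sub, ← Module.End.mul_apply, ← map_mul, ← Module.End.mul_apply,
        ← map_mul]
      simp [mul_assoc]
  -- On a generator `ρM g c - c`, split `c` into `s (π c)` and an element of `N`. The second part
  -- contributes to `T` because `G` acts trivially on `N/T`, the first by `hsg`. At `i z` the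
  -- correction `s (π (i z))` vanishes.
  have key : ∀ c ∈ Representation.Coinvariants.ker ρM, c - s (π c) ∈ T.map i := by
    intro c hc
    induction hc using Submodule.span_induction with
    | mem c hc =>
      obtain ⟨⟨g, c⟩, rfl⟩ := hc
      simp only [map_sub, hπρ]
      have h1 : c - s (π c) ∈ LinearMap.range i := by
        rw [← hπ, LinearMap.mem_ker, map_sub, hπs, sub_self]
      obtain ⟨n, hn⟩ := h1
      have h2 : i (ρN g n - n) ∈ T.map i := ⟨_, hT g n, rfl⟩
      rw [map_sub, hiρ, hn] at h2
      have h3 := add_mem h2 (hsg g (π c))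
      rw [map_sub] at h3
      convert h3 using 1
      abel
    | zero => simp
    | add x y _ _ hx hy =>
      simp only [map_add]
      rw [add_sub_add_comm]
      exact add_mem hx hy
    | smul a x _ hx =>
      rw [map_smul, map_smul, ← smul_sub]
      exact Submodule.smul_mem _ _ hx
  have hz0 : π (i z) = 0 := by
    rw [← LinearMap.mem_ker, hπ]
    exact ⟨z, rfl⟩
  have := key _ hz
  rw [hz0, map_zero, sub_zero] at this
  obtain ⟨y, hy, hyz⟩ := this
  rwa [← hi hyz]

end abstract_coinvariants

/-! ### The image of the connecting map as a kernel on coinvariants -/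

section connecting

theorem H0π_eq_zero_iff {k G : Type} [CommRing k] [Group G] (A : Rep k G) (x : A) :
    groupHomology.H0π A x = 0 ↔ x ∈ Representation.Coinvariants.ker A.ρ := by
  rw [← Representation.Coinvariants.mk_eq_zero]
  have h : (groupHomology.H0Iso A).hom (groupHomology.H0π A x) =
      Representation.Coinvariants.mk A.ρ x :=
    congrArg (fun f => f.hom x) (groupHomology.H0π_comp_H0Iso_hom A)
  rw [← h]
  constructor
  · intro h0
    rw [h0, map_zero]
  · intro h0
    exact (groupHomology.H0Iso A).toLinearEquiv.map_eq_zero_iff.1 h0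

variable (Γ : Subgroup SL(3, ℤ)) (E : Type) [Field E] [CharZero E]

/-- Exactness of the long homology sequence at H₀(Γ, St(ℚ³)). -/
theorem mem_HSpace_iff_map_eq_zero (y : SteinbergH0 Γ) :
    y ∈ HSpace Γ E ↔ (groupHomology.functor ℚ Γ 0).map (steinbergSequence Γ E).f y = 0 := by
  have h := (groupHomology.mapShortComplex₁_exact (steinbergSequence_shortExact Γ E)
    (i := 1) (j := 0) rfl).moduleCat_range_eq_ker
  have h2 := congrArg (y ∈ ·) h
  exact iff_of_eq h2

theorem H0π_mem_HSpace_iff (z : Steinberg ℚ) :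
    groupHomology.H0π (Rep.of (steinbergRepOn ℚ Γ)) z ∈ HSpace Γ E ↔
      steinbergIncl E z ∈ Representation.Coinvariants.ker (steinbergRepOn E Γ) := by
  rw [mem_HSpace_iff_map_eq_zero]
  have h : (groupHomology.functor ℚ Γ 0).map (steinbergSequence Γ E).f
      (groupHomology.H0π (Rep.of (steinbergRepOn ℚ Γ)) z) =
      groupHomology.H0π (Rep.of (steinbergRepOn E Γ)) (steinbergIncl E z) :=
    congrArg (fun f : ModuleCat.of ℚ (Steinberg ℚ) ⟶
        groupHomology.H0 (Rep.of (steinbergRepOn E Γ)) => f.hom z)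
      (groupHomology.H0π_comp_map (A := (steinbergSequence Γ E).X₁)
        (B := (steinbergSequence Γ E).X₂) (MonoidHom.id Γ) (steinbergSequence Γ E).f)
  exact (iff_of_eq (congrArg (· = 0) h)).trans
    (H0π_eq_zero_iff (Rep.of (steinbergRepOn E Γ)) (steinbergIncl E z))

end connecting

/-! ### Apartments as differences of paths -/

section edgeChain

variable {K L : Type*} [Field K] [Field L]

open Classical in
/-- The edge `V < W` of `T(K³)` as a chain; it is `0` if `V < W` is not an edge. -/
def edgeChain (V W : Submodule K (Fin 3 → K)) : TitsEdge K →₀ ℚ :=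
  if h : (V ≠ ⊥ ∧ V ≠ ⊤) ∧ (W ≠ ⊥ ∧ W ≠ ⊤) ∧ V < W then
    Finsupp.single ⟨(⟨V, h.1⟩, ⟨W, h.2.1⟩), h.2.2⟩ 1
  else 0

theorem edgeChain_coe (e : TitsEdge K) :
    edgeChain e.1.1.1 e.1.2.1 = Finsupp.single e 1 :=
  dif_pos ⟨e.1.1.2, e.1.2.2, e.2⟩

theorem mapDomain_edgeChain (φ : TitsVertex K → TitsVertex L) (hφ : StrictMono φ)
    (F : Submodule K (Fin 3 → K) → Submodule L (Fin 3 → L)) (hF : ∀ V, (φ V).1 = F V.1)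
    {V W : Submodule K (Fin 3 → K)} (hV : V ≠ ⊥) (hVW : V < W) (hW : W ≠ ⊤) :
    Finsupp.mapDomain (edgeMap φ hφ) (edgeChain V W) = edgeChain (F V) (F W) := by
  have h := edgeChain_coe (K := K)
    ⟨(⟨V, hV, (hVW.trans_le le_top).ne⟩, ⟨W, (bot_le.trans_lt hVW).ne', hW⟩), hVW⟩
  have h2 := edgeChain_coe (edgeMap φ hφ
    ⟨(⟨V, hV, (hVW.trans_le le_top).ne⟩, ⟨W, (bot_le.trans_lt hVW).ne', hW⟩), hVW⟩)
  rw [h, Finsupp.mapDomain_single, ← h2]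
  simp only [edgeMap, hF]

/-- The path from the vertex `A` to the plane `P` through `X` in the Tits building, with reference
edges chosen so that the apartment of `x, y, a` is the difference of the paths of `x` and `y`. -/
def planePath (P A X : Submodule K (Fin 3 → K)) : TitsEdge K →₀ ℚ :=
  edgeChain X P - edgeChain X (X ⊔ A) + edgeChain A (X ⊔ A)

/-- Under these hypotheses all three edges of `planePath` are genuine flags, so the default value 0
of `edgeChain` does not intervene when they are pushed forward. -/
theorem planePath_flags {P : Submodule K (Fin 3 → K)} (hP : Module.finrank K P = 2)
    {x a : Fin 3 → K} (hx : x ∈ P) (hx0 : x ≠ 0) (ha : a ∉ P) :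
    Submodule.span K {x} ≠ ⊥ ∧ Submodule.span K {x} < P ∧ P ≠ ⊤ ∧ Submodule.span K {a} ≠ ⊥ ∧
      Submodule.span K {x} < Submodule.span K {x} ⊔ Submodule.span K {a} ∧
      Submodule.span K {a} < Submodule.span K {x} ⊔ Submodule.span K {a} ∧
      Submodule.span K {x} ⊔ Submodule.span K {a} ≠ ⊤ := by
  have ha0 : a ≠ 0 := fun h => ha (h ▸ P.zero_mem)
  have hxP : Submodule.span K {x} ≤ P := by simpa using hx
  refine ⟨by simpa using hx0, lt_of_le_of_ne hxP ?_, ?_, by simpa using ha0,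
    lt_of_le_of_ne le_sup_left ?_, lt_of_le_of_ne le_sup_right ?_, ?_⟩
  · rintro rfl
    rw [finrank_span_singleton hx0] at hP
    omega
  · rintro rfl
    exact ha trivial
  · intro h
    apply ha
    apply hxP
    rw [h]
    exact Submodule.mem_sup_right (Submodule.mem_span_singleton_self a)
  · intro h
    have h1 : x ∈ Submodule.span K {a} := by
      rw [h]
      exact Submodule.mem_sup_left (Submodule.mem_span_singleton_self x)
    obtain ⟨c, rfl⟩ := Submodule.mem_span_singleton.1 h1
    have hc : c ≠ 0 := fun h => hx0 (by simp [h])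
    exact ha ((P.smul_mem_iff hc).1 hx)
  · intro h
    have h1 := Submodule.finrank_add_le_finrank_add_finrank (Submodule.span K {x})
      (Submodule.span K {a})
    rw [h, finrank_top, finrank_span_singleton hx0, finrank_span_singleton ha0] at h1
    simp at h1

theorem mapDomain_planePath (φ : TitsVertex K → TitsVertex L) (hφ : StrictMono φ)
    (F : Submodule K (Fin 3 → K) → Submodule L (Fin 3 → L)) (hF : ∀ V, (φ V).1 = F V.1)
    (hsup : ∀ V W, F (V ⊔ W) = F V ⊔ F W)
    {P : Submodule K (Fin 3 → K)} (hP : Module.finrank K P = 2)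
    {x a : Fin 3 → K} (hx : x ∈ P) (hx0 : x ≠ 0) (ha : a ∉ P) :
    Finsupp.mapDomain (edgeMap φ hφ) (planePath P (Submodule.span K {a}) (Submodule.span K {x})) =
      planePath (F P) (F (Submodule.span K {a})) (F (Submodule.span K {x})) := by
  obtain ⟨h1, h2, h3, h4, h5, h6, h7⟩ := planePath_flags hP hx hx0 ha
  have hsub : ∀ u v : TitsEdge K →₀ ℚ, Finsupp.mapDomain (edgeMap φ hφ) (u - v) =
      Finsupp.mapDomain (edgeMap φ hφ) u - Finsupp.mapDomain (edgeMap φ hφ) v :=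
    fun u v => map_sub (Finsupp.lmapDomain ℚ ℚ (edgeMap φ hφ)) u v
  rw [planePath, Finsupp.mapDomain_add, hsub, mapDomain_edgeChain φ hφ F hF h1 h2 h3,
    mapDomain_edgeChain φ hφ F hF h1 h5 h7, mapDomain_edgeChain φ hφ F hF h4 h6 h7, hsup, planePath]

theorem modularSymbol_coe {x y z : Fin 3 → K} (h : LinearIndependent K ![x, y, z]) :
    (modularSymbol x y z : TitsEdge K →₀ ℚ) =
      edgeChain (Submodule.span K {x}) (Submodule.span K {x, y})
      - edgeChain (Submodule.span K {x}) (Submodule.span K {x, z})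
      + edgeChain (Submodule.span K {z}) (Submodule.span K {x, z})
      - (edgeChain (Submodule.span K {y}) (Submodule.span K {x, y})
      - edgeChain (Submodule.span K {y}) (Submodule.span K {y, z})
      + edgeChain (Submodule.span K {z}) (Submodule.span K {y, z})) := by
  have hs : ∀ s, Finsupp.single (apartmentEdge ![x, y, z] h s) (1 : ℚ) =
      edgeChain (Submodule.span K (![x, y, z] '' {s 0}))
        (Submodule.span K (![x, y, z] '' {s 0, s 1})) :=
    fun s => (edgeChain_coe _).symm
  have hu : (Finset.univ : Finset (Equiv.Perm (Fin 3))) =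
      {1, Equiv.swap 0 1, Equiv.swap 1 2, Equiv.swap 0 2, Equiv.swap 0 1 * Equiv.swap 1 2,
        Equiv.swap 1 2 * Equiv.swap 0 1} := by decide
  rw [modularSymbol, dif_pos h]
  change apartmentChain _ h = _
  rw [apartmentChain]
  simp only [hs]
  rw [hu, Finset.sum_insert (by decide), Finset.sum_insert (by decide),
    Finset.sum_insert (by decide), Finset.sum_insert (by decide), Finset.sum_insert (by decide),
    Finset.sum_singleton]
  have e1 : Equiv.swap (1 : Fin 3) 2 0 = 0 := by decide
  have e2 : Equiv.swap (0 : Fin 3) 2 1 = 1 := by decide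
  have e3 : Equiv.swap (0 : Fin 3) 1 2 = 2 := by decide
  have n1 : (0 : Fin 3) ≠ 1 := by decide
  have n2 : (0 : Fin 3) ≠ 2 := by decide
  have n3 : (1 : Fin 3) ≠ 2 := by decide
  simp only [Equiv.Perm.sign_one, Equiv.Perm.sign_mul, Equiv.Perm.sign_swap n1,
    Equiv.Perm.sign_swap n2, Equiv.Perm.sign_swap n3, Equiv.Perm.one_apply,
    Equiv.Perm.mul_apply, Equiv.swap_apply_left, Equiv.swap_apply_right, e1, e2, e3,
    Set.image_singleton, Set.image_pair]
  simp only [Matrix.cons_val_zero, Matrix.cons_val_one, Matrix.cons_val, Units.val_one,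
    Units.val_neg, Units.val_mul, Set.pair_comm z, Set.pair_comm y x]
  norm_num
  abel

/-- If x and y are independent they span `P`, and the hexagon splits into its two halves. If they
are proportional, both sides are 0, as the two paths coincide. Independence therefore need not be
tracked, which matters for `x = f`, `y = γ f`. -/
theorem modularSymbol_eq_planePath {P : Submodule K (Fin 3 → K)} (hP : Module.finrank K P = 2)
    {x y a : Fin 3 → K} (hx : x ∈ P) (hx0 : x ≠ 0) (hy : y ∈ P) (hy0 : y ≠ 0) (ha : a ∉ P) :
    (modularSymbol x y a : TitsEdge K →₀ ℚ) =
      planePath P (Submodule.span K {a}) (Submodule.span K {x}) -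
        planePath P (Submodule.span K {a}) (Submodule.span K {y}) := by
  have hsn : (Fin.snoc ![x, y] a : Fin 3 → Fin 3 → K) = ![x, y, a] := by
    ext i
    fin_cases i <;> rfl
  have hle : Submodule.span K {x, y} ≤ P := by
    rw [Submodule.span_le]
    rintro _ (rfl | rfl) <;> assumption
  have hr : Set.range ![x, y] = {x, y} := by
    ext t
    simp [eq_comm, or_comm]
  by_cases h : LinearIndependent K ![x, y]
  · have h3 : LinearIndependent K ![x, y, a] := by
      rw [← hsn, linearIndependent_finSnoc]
      refine ⟨h, fun ha' => ha (hle ?_)⟩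
      rwa [hr] at ha'
    have hxy : Submodule.span K {x, y} = P := by
      refine Submodule.eq_of_le_of_finrank_eq hle ?_
      have := finrank_span_eq_card h
      rw [hr, Fintype.card_fin] at this
      rw [this, hP]
    rw [modularSymbol_coe h3, hxy, planePath, planePath, Submodule.span_insert x,
      Submodule.span_insert y]
  · have h3 : ¬ LinearIndependent K ![x, y, a] := by
      rw [← hsn, linearIndependent_finSnoc]
      exact fun h' => h h'.1
    rw [LinearIndependent.pair_iff' hx0] at h
    push Not at h
    obtain ⟨c, rfl⟩ := h
    have hc : c ≠ 0 := fun h => hy0 (by simp [h])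
    rw [Submodule.span_singleton_smul_eq (IsUnit.mk0 c hc), sub_self, modularSymbol, dif_neg h3]
    rfl

end edgeChain

/-! ### Extension of scalars on subspaces -/

section extend

variable (E : Type*) [Field E] [CharZero E]

/-- The inclusion `ℚ³ ⊂ E³` as a linear map. -/
def inclLinear : (Fin 3 → ℚ) →ₗ[ℚ] (Fin 3 → E) where
  toFun := incl E
  map_add' x y := by ext; simp [incl]
  map_smul' c x := by ext; simp [incl, Algebra.smul_def]

theorem incl_add (x y : Fin 3 → ℚ) : incl E (x + y) = incl E x + incl E y :=
  map_add (inclLinear E) x y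

theorem incl_smul (c : ℚ) (x : Fin 3 → ℚ) : incl E (c • x) = (c : E) • incl E x := by
  ext; simp [incl]

theorem incl_eq_zero_iff (x : Fin 3 → ℚ) : incl E x = 0 ↔ x = 0 := by
  simp [incl, funext_iff]

theorem extend_span (S : Set (Fin 3 → ℚ)) :
    extend E (Submodule.span ℚ S) = Submodule.span E (incl E '' S) := by
  apply le_antisymm
  · rw [extend, Submodule.span_le]
    rintro _ ⟨x, hx, rfl⟩
    induction hx using Submodule.span_induction with
    | mem x hx => exact Submodule.subset_span ⟨x, hx, rfl⟩
    | zero =>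
      rw [(incl_eq_zero_iff E 0).2 rfl]
      exact Submodule.zero_mem _
    | add x y _ _ hx hy =>
      rw [incl_add]
      exact Submodule.add_mem _ hx hy
    | smul c x _ hx =>
      rw [incl_smul]
      exact Submodule.smul_mem _ _ hx
  · exact Submodule.span_mono (Set.image_mono Submodule.subset_span)

theorem extend_span_singleton (x : Fin 3 → ℚ) :
    extend E (Submodule.span ℚ {x}) = Submodule.span E {incl E x} := by
  rw [extend_span, Set.image_singleton]

omit [CharZero E] in
theorem extend_mono {V W : Submodule ℚ (Fin 3 → ℚ)} (h : V ≤ W) : extend E V ≤ extend E W :=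
  Submodule.span_mono (Set.image_mono h)

theorem extend_le_extend_iff {V W : Submodule ℚ (Fin 3 → ℚ)} :
    extend E V ≤ extend E W ↔ V ≤ W := by
  refine ⟨fun h x hx => ?_, extend_mono E⟩
  rw [← incl_mem_extend_iff E] at hx ⊢
  exact h hx

theorem extend_sup (V W : Submodule ℚ (Fin 3 → ℚ)) :
    extend E (V ⊔ W) = extend E V ⊔ extend E W := by
  conv_lhs => rw [← Submodule.span_eq V, ← Submodule.span_eq W]
  rw [← Submodule.span_union, extend_span, Set.image_union, Submodule.span_union]
  rfl

theorem extend_top : extend E ⊤ = ⊤ := by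
  rw [eq_top_iff]
  intro x _
  rw [pi_eq_sum_univ x]
  refine Submodule.sum_mem _ fun i _ => Submodule.smul_mem _ _ ?_
  convert (incl_mem_extend_iff E ⊤ (fun j => if i = j then 1 else 0)).2 trivial
  simp only [incl]
  split_ifs <;> simp

theorem finrank_extend_le (V : Submodule ℚ (Fin 3 → ℚ)) :
    Module.finrank E (extend E V) ≤ Module.finrank ℚ V := by
  let b := Module.finBasis ℚ V
  have h : V = Submodule.span ℚ (Set.range fun i => (b i : Fin 3 → ℚ)) := by
    have := congrArg (Submodule.map V.subtype) b.span_eq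
    rw [Submodule.map_span, ← Set.range_comp, Submodule.map_top, Submodule.range_subtype] at this
    exact this.symm
  have h2 : extend E V = Submodule.span E (Set.range fun i => incl E (b i)) := by
    conv_lhs => rw [h]
    rw [extend_span, ← Set.range_comp]
    rfl
  rw [h2]
  exact (finrank_range_le_card _).trans (by simp)

/-- The inequality ≤ holds for `V` and for a complement `W`, and the extensions of the two together
span E³, so both inequalities are equalities. -/
theorem finrank_extend (V : Submodule ℚ (Fin 3 → ℚ)) :
    Module.finrank E (extend E V) = Module.finrank ℚ V := by
  obtain ⟨W, hW⟩ := Submodule.exists_isCompl V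
  have h1 := Submodule.finrank_add_eq_of_isCompl hW
  have h2 := Submodule.finrank_add_le_finrank_add_finrank (extend E V) (extend E W)
  rw [← extend_sup, hW.sup_eq_top, extend_top, finrank_top] at h2
  have h3 := finrank_extend_le E V
  have h4 := finrank_extend_le E W
  simp only [Module.finrank_fin_fun] at h1 h2
  omega

end extend

/-! ### Cycles without doubly irrational edges are rational -/

section irrational

variable (E : Type*) [Field E] [CharZero E]

/-- The vertices of `T(E³)` which do not come from `T(ℚ³)`. -/
def irrationalVertices : Set (TitsVertex E) := (Set.range (extendVertex E))ᶜ

/-- The edges of `T(E³)` neither of whose vertices comes from `T(ℚ³)`. -/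
def irrationalEdges : Set (TitsEdge E) :=
  {e | e.1.1 ∈ irrationalVertices E ∧ e.1.2 ∈ irrationalVertices E}

theorem irrationalVertices_of_extend {V : TitsVertex E} (hV : V ∈ irrationalVertices E)
    (W : Submodule ℚ (Fin 3 → ℚ)) : V.1 ≠ extend E W := by
  intro h
  refine hV ⟨⟨W, ?_, ?_⟩, Subtype.ext h.symm⟩
  · rintro rfl
    apply V.2.1
    rw [h, extend]
    simp [(incl_eq_zero_iff E 0).2 rfl]
  · rintro rfl
    exact V.2.2 (h.trans (extend_top E))

theorem titsEdge_finrank {K : Type*} [Field K] {V W : TitsVertex K} (h : V < W) :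
    Module.finrank K V.1 = 1 ∧ Module.finrank K W.1 = 2 := by
  have h1 := Submodule.finrank_lt_finrank_of_lt (show V.1 < W.1 from h)
  have h2 := Submodule.finrank_lt W.2.2
  have h3 : 0 < Module.finrank K V.1 := by
    rw [Nat.pos_iff_ne_zero, Ne, Submodule.finrank_eq_zero]
    exact V.2.1
  simp only [Module.finrank_fin_fun] at h2
  omega

/-- Two distinct rational planes meet in a rational point, and by dimension `V` would be that point.
-/
theorem eq_of_irrational_lt {V : TitsVertex E} (hV : V ∈ irrationalVertices E)
    {W₁ W₂ : TitsVertex ℚ} (h₁ : V < extendVertex E W₁) (h₂ : V < extendVertex E W₂) :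
    W₁ = W₂ := by
  have d1 : Module.finrank E (extend E W₁.1) = 2 := (titsEdge_finrank h₁).2
  have d2 : Module.finrank E (extend E W₂.1) = 2 := (titsEdge_finrank h₂).2
  have dV := (titsEdge_finrank h₁).1
  have e1 := d1
  have e2 := d2
  rw [finrank_extend] at e1 e2
  by_contra hne
  have hlt : extend E W₁.1 ⊓ extend E W₂.1 < extend E W₁.1 := by
    refine lt_of_le_of_ne inf_le_left fun h => hne (extendVertex_injective E (Subtype.ext ?_))
    exact Submodule.eq_of_le_of_finrank_eq (inf_eq_left.1 h) (d1.trans d2.symm)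
  have h3 := Submodule.finrank_lt_finrank_of_lt hlt
  have h4 := Submodule.finrank_sup_add_finrank_inf_eq W₁.1 W₂.1
  have h5 := Submodule.finrank_le (W₁.1 ⊔ W₂.1)
  simp only [Module.finrank_fin_fun] at h5
  have h6 : V.1 = extend E W₁.1 ⊓ extend E W₂.1 :=
    Submodule.eq_of_le_of_finrank_le (le_inf h₁.le h₂.le) (by omega)
  have h7 : extend E (W₁.1 ⊓ W₂.1) = V.1 := by
    refine Submodule.eq_of_le_of_finrank_le ?_ ?_
    · rw [h6]
      exact le_inf (extend_mono E inf_le_left) (extend_mono E inf_le_right)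
    · rw [finrank_extend]
      omega
  exact irrationalVertices_of_extend E hV _ h7.symm

/-- Dually, two distinct rational points span a rational plane, which would be `V`. -/
theorem eq_of_lt_irrational {V : TitsVertex E} (hV : V ∈ irrationalVertices E)
    {W₁ W₂ : TitsVertex ℚ} (h₁ : extendVertex E W₁ < V) (h₂ : extendVertex E W₂ < V) :
    W₁ = W₂ := by
  have d1 : Module.finrank E (extend E W₁.1) = 1 := (titsEdge_finrank h₁).1
  have d2 : Module.finrank E (extend E W₂.1) = 1 := (titsEdge_finrank h₂).1
  have dV := (titsEdge_finrank h₁).2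
  by_contra hne
  have hlt : extend E W₁.1 < extend E W₁.1 ⊔ extend E W₂.1 := by
    refine lt_of_le_of_ne le_sup_left fun h => hne (extendVertex_injective E (Subtype.ext ?_))
    exact (Submodule.eq_of_le_of_finrank_eq (sup_eq_left.1 h.symm) (d2.trans d1.symm)).symm
  have h3 := Submodule.finrank_lt_finrank_of_lt hlt
  have h6 : extend E W₁.1 ⊔ extend E W₂.1 = V.1 :=
    Submodule.eq_of_le_of_finrank_le (sup_le h₁.le h₂.le) (by omega)
  rw [← extend_sup] at h6
  exact irrationalVertices_of_extend E hV _ h6.symm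

/-- Restriction of a cycle to the edges neither of whose vertices is rational. -/
def irrationalPart : Steinberg E →ₗ[ℚ] (irrationalEdges E →₀ ℚ) :=
  Finsupp.lsubtypeDomain (irrationalEdges E) ∘ₗ (Steinberg E).subtype

theorem irrationalPart_apply (c : Steinberg E) (e : irrationalEdges E) :
    irrationalPart E c e = c.1 e.1 := rfl

theorem boundary_apply {K : Type*} [Field K] (c : TitsEdge K →₀ ℚ) (V : TitsVertex K) :
    boundary K c V = c.sum fun e r => r * ((if e.1.2 = V then 1 else 0) -
      (if e.1.1 = V then 1 else 0)) := by
  classical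
  rw [boundary, Finsupp.linearCombination_apply, Finsupp.sum_apply]
  simp [Finsupp.single_apply]

/-- Read off the boundary at the irrational point of `e`. Any other edge at that point either is
doubly irrational, with coefficient 0, or leads to a rational plane, which is unique; so the
coefficient of `e` is all that remains. -/
theorem eq_zero_of_irrational_left {c : Steinberg E} (hc : irrationalPart E c = 0)
    {e : TitsEdge E} (h1 : e.1.1 ∈ irrationalVertices E) (h2 : e.1.2 ∉ irrationalVertices E) :
    c.1 e = 0 := by
  classical
  have hb : boundary E c.1 e.1.1 = 0 := by
    rw [LinearMap.mem_ker.1 c.2]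
    rfl
  rw [boundary_apply, Finsupp.sum, Finset.sum_eq_single e] at hb
  · rw [if_neg e.2.ne', if_pos rfl] at hb
    linarith
  · intro e' he' hne
    have h0 : e'.1.2 ≠ e.1.1 := fun h => not_flag_three e'.1.1 e.1.1 e.1.2 ⟨h ▸ e'.2, e.2⟩
    rw [if_neg h0, if_neg, sub_zero, mul_zero]
    intro h
    by_cases h3 : e'.1.2 ∈ irrationalVertices E
    · have : c.1 e' = 0 := DFunLike.congr_fun hc ⟨e', by rwa [h], h3⟩
      exact Finsupp.mem_support_iff.1 he' this
    · obtain ⟨W, hW⟩ := not_not.1 h2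
      obtain ⟨W', hW'⟩ := not_not.1 h3
      have hlt := e.2
      have hlt' := e'.2
      rw [h, ← hW'] at hlt'
      rw [← hW] at hlt
      have := eq_of_irrational_lt E h1 hlt hlt'
      apply hne
      apply Subtype.ext
      apply Prod.ext h
      rw [← hW, ← hW', this]
  · intro he
    rw [Finsupp.notMem_support_iff.1 he, zero_mul]

theorem eq_zero_of_irrational_right {c : Steinberg E} (hc : irrationalPart E c = 0)
    {e : TitsEdge E} (h1 : e.1.1 ∉ irrationalVertices E) (h2 : e.1.2 ∈ irrationalVertices E) :
    c.1 e = 0 := by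
  classical
  have hb : boundary E c.1 e.1.2 = 0 := by
    rw [LinearMap.mem_ker.1 c.2]
    rfl
  rw [boundary_apply, Finsupp.sum, Finset.sum_eq_single e] at hb
  · rw [if_pos rfl, if_neg e.2.ne] at hb
    linarith
  · intro e' he' hne
    have h0 : e'.1.1 ≠ e.1.2 := fun h => not_flag_three e.1.1 e.1.2 e'.1.2 ⟨e.2, h ▸ e'.2⟩
    rw [if_neg h0, if_neg, sub_zero, mul_zero]
    intro h
    by_cases h3 : e'.1.1 ∈ irrationalVertices E
    · have : c.1 e' = 0 := DFunLike.congr_fun hc ⟨e', h3, by rwa [h]⟩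
      exact Finsupp.mem_support_iff.1 he' this
    · obtain ⟨W, hW⟩ := not_not.1 h1
      obtain ⟨W', hW'⟩ := not_not.1 h3
      have hlt := e.2
      have hlt' := e'.2
      rw [h, ← hW'] at hlt'
      rw [← hW] at hlt
      have := eq_of_lt_irrational E h2 hlt hlt'
      apply hne
      apply Subtype.ext
      refine Prod.ext ?_ h
      rw [← hW, ← hW', this]
  · intro he
    rw [Finsupp.notMem_support_iff.1 he, zero_mul]

theorem edgeMap_extendVertex_injective :
    Function.Injective (edgeMap (extendVertex E) (extendVertex_strictMono E)) := by
  intro e e' he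
  have h1 := congrArg (fun t : TitsEdge E => t.1.1) he
  have h2 := congrArg (fun t : TitsEdge E => t.1.2) he
  exact Subtype.ext (Prod.ext (extendVertex_injective E h1) (extendVertex_injective E h2))

/-- The two preceding vanishing results leave only edges with both ends rational. The chain then
descends to T(ℚ³), and it is a cycle there because the map on vertices is injective. -/
theorem ker_irrationalPart :
    LinearMap.ker (irrationalPart E) = LinearMap.range (steinbergIncl E) := by
  apply le_antisymm
  · intro c hc
    rw [LinearMap.mem_ker] at hc
    have hsupp : (c.1.support : Set (TitsEdge E)) ⊆
        Set.range (edgeMap (extendVertex E) (extendVertex_strictMono E)) := by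
      intro e he
      have he0 : c.1 e ≠ 0 := Finsupp.mem_support_iff.1 he
      by_cases h1 : e.1.1 ∈ irrationalVertices E
      · by_cases h2 : e.1.2 ∈ irrationalVertices E
        · exact absurd (DFunLike.congr_fun hc ⟨e, h1, h2⟩) he0
        · exact absurd (eq_zero_of_irrational_left E hc h1 h2) he0
      · by_cases h2 : e.1.2 ∈ irrationalVertices E
        · exact absurd (eq_zero_of_irrational_right E hc h1 h2) he0
        · obtain ⟨V, hV⟩ := not_not.1 h1
          obtain ⟨W, hW⟩ := not_not.1 h2
          have hlt := e.2
          rw [← hV, ← hW] at hlt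
          have hVW : V < W := by
            refine lt_of_le_of_ne ((extend_le_extend_iff E).1 hlt.le) ?_
            rintro rfl
            exact hlt.ne rfl
          exact ⟨⟨(V, W), hVW⟩, Subtype.ext (Prod.ext hV hW)⟩
    have hc' := Finsupp.mapDomain_comapDomain _ (edgeMap_extendVertex_injective E) c.1 hsupp
    set z := Finsupp.comapDomain (edgeMap (extendVertex E) (extendVertex_strictMono E)) c.1
      (edgeMap_extendVertex_injective E).injOn
    refine ⟨⟨z, ?_⟩, Subtype.ext hc'⟩
    rw [Steinberg, LinearMap.mem_ker]
    apply Finsupp.mapDomain_injective (extendVertex_injective E)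
    have := boundary_lmapDomain (extendVertex E) (extendVertex_strictMono E) z
    rw [Finsupp.lmapDomain_apply, Finsupp.lmapDomain_apply, hc', LinearMap.mem_ker.1 c.2] at this
    rw [← this, Finsupp.mapDomain_zero]
  · rintro _ ⟨z, rfl⟩
    rw [LinearMap.mem_ker]
    ext e
    refine Finsupp.mapDomain_of_notMem_range _ _ ?_
    rintro ⟨e', he'⟩
    exact e.2.1 ⟨e'.1.1, congrArg (fun t : TitsEdge E => t.1.1) he'⟩

end irrational

/-! ### The action on doubly irrational edges -/

section irrationalAction

variable {E : Type*} [Field E] [CharZero E]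

theorem vertexAct_mem_irrationalVertices (g : SL(3, ℤ)) {V : TitsVertex E}
    (hV : V ∈ irrationalVertices E) : vertexAct (toGLK E g) V ∈ irrationalVertices E := by
  rintro ⟨W, hW⟩
  refine hV ⟨vertexAct (toGLK ℚ g⁻¹) W, ?_⟩
  rw [extendVertex_vertexAct, hW, ← vertexAct_mul, ← map_mul, inv_mul_cancel, map_one,
    vertexAct_one]

/-- The action of `SL₃(ℤ)` on the edges of `T(E³)` neither of whose vertices is rational. -/
instance irrationalEdgesAction : MulAction SL(3, ℤ) (irrationalEdges E) where
  smul g e := ⟨edgeMap _ (vertexAct_strictMono (toGLK E g)) e.1,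
    vertexAct_mem_irrationalVertices g e.2.1, vertexAct_mem_irrationalVertices g e.2.2⟩
  one_smul e := by
    refine Subtype.ext (Subtype.ext (Prod.ext ?_ ?_)) <;>
    · change vertexAct (toGLK E 1) _ = _
      rw [map_one, vertexAct_one]
  mul_smul g h e := by
    refine Subtype.ext (Subtype.ext (Prod.ext ?_ ?_)) <;>
    · change vertexAct (toGLK E (g * h)) _ = vertexAct _ (vertexAct _ _)
      rw [map_mul, vertexAct_mul]

theorem irrationalPart_steinbergRep (g : SL(3, ℤ)) (c : Steinberg E) :
    irrationalPart E (steinbergRep E (toGLK E g) c) =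
      Finsupp.mapDomain (g • ·) (irrationalPart E c) := by
  have hinj : Function.Injective (edgeMap _ (vertexAct_strictMono (toGLK E g))) := by
    have hv : Function.Injective (vertexAct (toGLK E g)) := fun V W h => Subtype.ext
      (Submodule.map_injective_of_injective (mulVecLin_injective _) (congrArg Subtype.val h))
    intro e e' he
    have h1 := congrArg (fun t : TitsEdge E => t.1.1) he
    have h2 := congrArg (fun t : TitsEdge E => t.1.2) he
    exact Subtype.ext (Prod.ext (hv h1) (hv h2))
  ext e
  obtain ⟨e, rfl⟩ := MulAction.surjective g e
  rw [Finsupp.mapDomain_apply (MulAction.injective g), irrationalPart_apply, irrationalPart_apply]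
  exact Finsupp.mapDomain_apply hinj _ _

end irrationalAction

/-! ### The action on subspaces and vectors -/

section act

variable (K : Type*) [Field K]

/-- The action of `SL₃(ℤ)` on the subspaces of `K³`. -/
def act (g : SL(3, ℤ)) (W : Submodule K (Fin 3 → K)) : Submodule K (Fin 3 → K) :=
  W.map (Matrix.mulVecLin (toGLK K g : Matrix (Fin 3) (Fin 3) K))

variable {K}

theorem act_mul (g h : SL(3, ℤ)) (W : Submodule K (Fin 3 → K)) :
    act K (g * h) W = act K g (act K h W) := by
  simp only [act, map_mul, Units.val_mul, Matrix.mulVecLin_mul, Submodule.map_comp]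

theorem act_one (W : Submodule K (Fin 3 → K)) : act K 1 W = W := by
  simp [act]

theorem act_inv_act (g : SL(3, ℤ)) (W : Submodule K (Fin 3 → K)) :
    act K g⁻¹ (act K g W) = W := by
  rw [← act_mul, inv_mul_cancel, act_one]

theorem act_sup (g : SL(3, ℤ)) (V W : Submodule K (Fin 3 → K)) :
    act K g (V ⊔ W) = act K g V ⊔ act K g W :=
  Submodule.map_sup _ _ _

theorem act_span_singleton (g : SL(3, ℤ)) (v : Fin 3 → K) :
    act K g (Submodule.span K {v}) =
      Submodule.span K {(toGLK K g : Matrix (Fin 3) (Fin 3) K).mulVec v} := by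
  rw [act, Submodule.map_span, Set.image_singleton]
  rfl

theorem mulVec_mem_act (g : SL(3, ℤ)) {W : Submodule K (Fin 3 → K)} {v : Fin 3 → K} (hv : v ∈ W) :
    (toGLK K g : Matrix (Fin 3) (Fin 3) K).mulVec v ∈ act K g W :=
  ⟨v, hv, rfl⟩

theorem mulVec_mem_act_iff (g : SL(3, ℤ)) {W : Submodule K (Fin 3 → K)} {v : Fin 3 → K} :
    (toGLK K g : Matrix (Fin 3) (Fin 3) K).mulVec v ∈ act K g W ↔ v ∈ W := by
  refine ⟨?_, mulVec_mem_act g⟩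
  rintro ⟨w, hw, h⟩
  rwa [← mulVecLin_injective _ h]

theorem mulVec_eq_zero_iff (g : SL(3, ℤ)) (v : Fin 3 → K) :
    (toGLK K g : Matrix (Fin 3) (Fin 3) K).mulVec v = 0 ↔ v = 0 :=
  LinearMap.map_eq_zero_iff (Matrix.mulVecLin _) (mulVecLin_injective (toGLK K g))

theorem mulVec_mul (g h : SL(3, ℤ)) (v : Fin 3 → K) :
    (toGLK K (g * h) : Matrix (Fin 3) (Fin 3) K).mulVec v =
      (toGLK K g : Matrix (Fin 3) (Fin 3) K).mulVec
        ((toGLK K h : Matrix (Fin 3) (Fin 3) K).mulVec v) := by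
  rw [map_mul, Units.val_mul, Matrix.mulVec_mulVec]

theorem finrank_act (g : SL(3, ℤ)) (W : Submodule K (Fin 3 → K)) :
    Module.finrank K (act K g W) = Module.finrank K W :=
  (Submodule.equivMapOfInjective _ (mulVecLin_injective (toGLK K g)) W).finrank_eq.symm

theorem mem_subspaceStabilizer_iff (g : SL(3, ℤ)) (W : Submodule K (Fin 3 → K)) :
    g ∈ subspaceStabilizer W ↔ act K g W = W := Iff.rfl

theorem act_conj_of_mem_subspaceStabilizer {g : SL(3, ℤ)} {W : Submodule K (Fin 3 → K)}
    (hg : g ∈ subspaceStabilizer W) (d : SL(3, ℤ)) : act K (d * g * d⁻¹) (act K d W) = act K d W := by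
  rw [act_mul, act_mul, act_inv_act, (mem_subspaceStabilizer_iff g W).1 hg]

/-- An invertible matrix cannot have eigenvalue 0 on a nonzero vector, so an eigenline is carried
onto itself; for `v = 0` both sides hold. -/
theorem isEigen_iff (g : SL(3, ℤ)) (v : Fin 3 → K) :
    IsEigen g v ↔ g ∈ subspaceStabilizer (Submodule.span K {v}) := by
  rw [mem_subspaceStabilizer_iff, act_span_singleton]
  constructor
  · rintro ⟨c, hc⟩
    rw [hc]
    by_cases hv : v = 0
    · simp [hv]
    · refine Submodule.span_singleton_smul_eq (IsUnit.mk0 c ?_) v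
      rintro rfl
      rw [zero_smul, mulVec_eq_zero_iff] at hc
      exact hv hc
  · intro h
    have h1 : (toGLK K g : Matrix (Fin 3) (Fin 3) K).mulVec v ∈ Submodule.span K {v} := by
      rw [← h]
      exact Submodule.mem_span_singleton_self _
    obtain ⟨c, hc⟩ := Submodule.mem_span_singleton.1 h1
    exact ⟨c, hc.symm⟩

theorem toGLK_mulVec_intVec (g : SL(3, ℤ)) (a : Fin 3 → ℤ) :
    (toGLK K g : Matrix (Fin 3) (Fin 3) K).mulVec (intVec K a) = intVec K (g.1.mulVec a) := by
  ext i
  simp [toGLK, intVec, Matrix.mulVec, dotProduct, Fin.sum_univ_three]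

theorem intVec_eq_zero_iff [CharZero K] (a : Fin 3 → ℤ) : intVec K a = 0 ↔ a = 0 := by
  simp [intVec, funext_iff]

variable (E : Type*) [Field E] [CharZero E]

omit [CharZero E] in
theorem incl_intVec (a : Fin 3 → ℤ) : incl E (intVec ℚ a) = intVec E a := by
  ext; simp [incl, intVec]

theorem extend_act (g : SL(3, ℤ)) (W : Submodule ℚ (Fin 3 → ℚ)) :
    extend E (act ℚ g W) = act E g (extend E W) := by
  simp only [act, extend]
  rw [Submodule.map_span, Submodule.map_coe, ← Set.image_comp, ← Set.image_comp]
  congr 1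
  refine Set.image_congr fun x _ => ?_
  exact (toGLK_mulVec_incl E g x).symm

end act

/-! ### The symbols [f, b, a] and their coboundaries -/

section symbols

theorem steinbergRep_modularSymbol {K : Type*} [Field K] (g : SL(3, ℤ))
    {P : Submodule K (Fin 3 → K)} (hP : Module.finrank K P = 2)
    {x y a : Fin 3 → K} (hx : x ∈ P) (hx0 : x ≠ 0) (hy : y ∈ P) (hy0 : y ≠ 0) (ha : a ∉ P) :
    (steinbergRep K (toGLK K g) (modularSymbol x y a) : TitsEdge K →₀ ℚ) =
      planePath (act K g P) (act K g (Submodule.span K {a})) (act K g (Submodule.span K {x})) -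
      planePath (act K g P) (act K g (Submodule.span K {a})) (act K g (Submodule.span K {y})) := by
  have h : (steinbergRep K (toGLK K g) (modularSymbol x y a) : TitsEdge K →₀ ℚ) =
    Finsupp.lmapDomain ℚ ℚ (edgeMap _ (vertexAct_strictMono (toGLK K g)))
      (modularSymbol x y a : TitsEdge K →₀ ℚ) := rfl
  rw [h, modularSymbol_eq_planePath hP hx hx0 hy hy0 ha, map_sub, Finsupp.lmapDomain_apply,
    Finsupp.lmapDomain_apply, mapDomain_planePath _ _ (act K g) (fun V => rfl) (act_sup g) hP hx hx0
    ha, mapDomain_planePath _ _ (act K g) (fun V => rfl) (act_sup g) hP hy hy0 ha]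

variable (E : Type*) [Field E] [CharZero E]

theorem steinbergIncl_modularSymbol {P : Submodule ℚ (Fin 3 → ℚ)} (hP : Module.finrank ℚ P = 2)
    {x y a : Fin 3 → ℚ} (hx : x ∈ P) (hx0 : x ≠ 0) (hy : y ∈ P) (hy0 : y ≠ 0) (ha : a ∉ P) :
    (steinbergIncl E (modularSymbol x y a) : TitsEdge E →₀ ℚ) =
      planePath (extend E P) (Submodule.span E {incl E a}) (Submodule.span E {incl E x}) -
      planePath (extend E P) (Submodule.span E {incl E a}) (Submodule.span E {incl E y}) := by
  have h : (steinbergIncl E (modularSymbol x y a) : TitsEdge E →₀ ℚ) =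
    Finsupp.lmapDomain ℚ ℚ (edgeMap _ (extendVertex_strictMono E))
      (modularSymbol x y a : TitsEdge ℚ →₀ ℚ) := rfl
  rw [h, modularSymbol_eq_planePath hP hx hx0 hy hy0 ha, map_sub, Finsupp.lmapDomain_apply,
    Finsupp.lmapDomain_apply, mapDomain_planePath _ _ (extend E) (fun V => rfl) (extend_sup E) hP hx
    hx0 ha, mapDomain_planePath _ _ (extend E) (fun V => rfl) (extend_sup E) hP hy hy0 ha,
    extend_span_singleton, extend_span_singleton, extend_span_singleton]

variable {E}

/-- If `γ` fixes the rational plane `P`, the point `a` and the point `b` of `P`, then the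
coboundary of `[f, b, a]` at `γ` is `-[f, γ f, a]` for each rational `f` in `P`. -/
theorem steinbergRep_sub_eq (γ : SL(3, ℤ)) {P : Submodule ℚ (Fin 3 → ℚ)}
    (hP : Module.finrank ℚ P = 2) {f a : Fin 3 → ℚ} {b : Fin 3 → E} (hf : f ∈ P) (hf0 : f ≠ 0)
    (ha : a ∉ P) (hb : b ∈ extend E P) (hb0 : b ≠ 0) (hγP : act ℚ γ P = P)
    (hγa : act ℚ γ (Submodule.span ℚ {a}) = Submodule.span ℚ {a})
    (hγb : act E γ (Submodule.span E {b}) = Submodule.span E {b}) :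
    steinbergIncl E (-modularSymbol f ((toGLK ℚ γ : Matrix (Fin 3) (Fin 3) ℚ).mulVec f) a) =
      steinbergRep E (toGLK E γ) (modularSymbol (incl E f) b (incl E a)) -
        modularSymbol (incl E f) b (incl E a) := by
  have hPE : Module.finrank E (extend E P) = 2 := (finrank_extend E P).trans hP
  have hfE := (incl_mem_extend_iff E P f).2 hf
  have hfE0 := (incl_eq_zero_iff E f).not.2 hf0
  have haE := (incl_mem_extend_iff E P a).not.2 ha
  have hγf : (toGLK ℚ γ : Matrix (Fin 3) (Fin 3) ℚ).mulVec f ∈ P := by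
    have := mulVec_mem_act γ hf
    rwa [hγP] at this
  rw [map_neg]
  apply Subtype.ext
  -- Since `γ` fixes `P`, `a` and `b`, the path through `b` is unchanged and cancels; the paths
  -- through `f` and `γ f` remain.
  rw [Submodule.coe_neg, Submodule.coe_sub, steinbergRep_modularSymbol γ hPE hfE hfE0 hb hb0 haE,
    modularSymbol_eq_planePath hPE hfE hfE0 hb hb0 haE,
    steinbergIncl_modularSymbol E hP hf hf0 hγf ((mulVec_eq_zero_iff γ f).not.2 hf0) ha,
    ← toGLK_mulVec_incl, ← act_span_singleton, ← extend_act, hγP, hγb, ← extend_span_singleton E a,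
    ← extend_act, hγa]
  abel

/-- For a rational plane `P`, a point `b` of `P`, and rational `f` in `P` and `a` not in `P`, the
only edge of the apartment of `f, b, a` which can have two irrational vertices is
`⟨b⟩ < ⟨b, a⟩`. -/
theorem irrationalPart_modularSymbol {P : Submodule ℚ (Fin 3 → ℚ)}
    (hP : Module.finrank ℚ P = 2) {f a : Fin 3 → ℚ} {b : Fin 3 → E} (hf : f ∈ P) (hf0 : f ≠ 0)
    (ha : a ∉ P) (hb : b ∈ extend E P) (hb0 : b ≠ 0) (e : irrationalEdges E)
    (he1 : e.1.1.1.1 = Submodule.span E {b})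
    (he2 : e.1.1.2.1 = Submodule.span E {b} ⊔ Submodule.span E {incl E a}) :
    irrationalPart E (modularSymbol (incl E f) b (incl E a)) = Finsupp.single e 1 := by
  classical
  have hPE : Module.finrank E (extend E P) = 2 := (finrank_extend E P).trans hP
  have hfE := (incl_mem_extend_iff E P f).2 hf
  have hfE0 := (incl_eq_zero_iff E f).not.2 hf0
  have haE := (incl_mem_extend_iff E P a).not.2 ha
  -- An edge with a rational end vanishes on X. This removes the whole path through `f` and all of
  -- the path through `b` except ⟨b⟩ < ⟨b, a⟩, whose two minus signs cancel.
  have hleft : ∀ V W (x : irrationalEdges E), edgeChain (extend E V) W x.1 = 0 := by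
    intro V W x
    rw [edgeChain]
    split_ifs with h
    · rw [Finsupp.single_eq_of_ne]
      intro hx
      exact irrationalVertices_of_extend E x.2.1 V (by rw [hx])
    · rfl
  have hright : ∀ V W (x : irrationalEdges E), edgeChain V (extend E W) x.1 = 0 := by
    intro V W x
    rw [edgeChain]
    split_ifs with h
    · rw [Finsupp.single_eq_of_ne]
      intro hx
      exact irrationalVertices_of_extend E x.2.2 W (by rw [hx])
    · rfl
  ext x
  rw [irrationalPart_apply, modularSymbol_eq_planePath hPE hfE hfE0 hb hb0 haE, planePath, planePath,
    ← he2, ← he1, edgeChain_coe, ← extend_span_singleton, ← extend_span_singleton]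
  simp only [Finsupp.sub_apply, Finsupp.add_apply, hleft, hright]
  simp [Finsupp.single_apply, Subtype.ext_iff]

end symbols

/-! ### Quadratic fields -/

section quadratic

variable {E : Type*} [Field E] [CharZero E]

theorem exists_notMem_range_cast (hE : Module.finrank ℚ E = 2) :
    ∃ β : E, β ∉ Set.range (Rat.cast : ℚ → E) := by
  by_contra! h
  have h1 : Module.finrank ℚ E = 1 := by
    refine finrank_eq_one (1 : E) one_ne_zero fun w => ?_
    obtain ⟨q, rfl⟩ := h w
    exact ⟨q, by simp [Algebra.smul_def]⟩
  omega

theorem exists_eq_add_mul (hE : Module.finrank ℚ E = 2) {β : E}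
    (hβ : β ∉ Set.range (Rat.cast : ℚ → E)) (x : E) : ∃ p q : ℚ, x = p + q * β := by
  have hli : LinearIndependent ℚ ![(1 : E), β] := by
    rw [LinearIndependent.pair_iff' one_ne_zero]
    rintro q rfl
    exact hβ ⟨q, by simp [Algebra.smul_def]⟩
  have hspan := hli.span_eq_top_of_card_eq_finrank (by simp [hE])
  have hx : x ∈ Submodule.span ℚ (Set.range ![(1 : E), β]) := hspan ▸ Submodule.mem_top
  obtain ⟨c, hc⟩ := (Submodule.mem_span_range_iff_exists_fun ℚ).1 hx
  refine ⟨c 0, c 1, ?_⟩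
  rw [← hc]
  simp [Fin.sum_univ_two, Algebra.smul_def]

theorem exists_algEquiv_ne_one [NumberField E] (hE : Module.finrank ℚ E = 2) :
    ∃ σ : E ≃ₐ[ℚ] E, σ ≠ 1 := by
  have : Algebra.IsQuadraticExtension ℚ E := ⟨hE⟩
  have h := IsGalois.card_aut_eq_finrank ℚ E
  rw [hE] at h
  have : Nontrivial (E ≃ₐ[ℚ] E) := by
    rw [← Finite.one_lt_card_iff_nontrivial, h]
    norm_num
  exact exists_ne 1

theorem algEquiv_apply_ne (hE : Module.finrank ℚ E = 2) {σ : E ≃ₐ[ℚ] E} (hσ : σ ≠ 1) {β : E}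
    (hβ : β ∉ Set.range (Rat.cast : ℚ → E)) : σ β ≠ β := by
  intro h
  apply hσ
  ext x
  obtain ⟨p, q, rfl⟩ := exists_eq_add_mul hE hβ x
  simp [h]

theorem eq_zero_of_add_mul_eq_zero {β : E} (hβ : β ∉ Set.range (Rat.cast : ℚ → E)) {p q : ℚ}
    (h : (p : E) + q * β = 0) : p = 0 ∧ q = 0 := by
  have hq : q = 0 := by
    by_contra hq
    apply hβ
    refine ⟨-p / q, ?_⟩
    have : (q : E) ≠ 0 := by exact_mod_cast hq
    push_cast
    field_simp
    linear_combination -h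
  subst hq
  refine ⟨?_, rfl⟩
  simpa using h

end quadratic

/-! ### Moving a rational plane to the standard one -/

section unimodular

theorem exists_unimodular_pair (p q : ℤ) :
    ∃ s x y t : ℤ, s * t - x * y = 1 ∧ p * s + q * y = 0 := by
  rcases Nat.eq_zero_or_pos (Int.gcd p q) with h | h
  · obtain ⟨rfl, rfl⟩ := Int.gcd_eq_zero_iff.1 h
    exact ⟨1, 0, 0, 1, by norm_num, by norm_num⟩
  · obtain ⟨p', q', hpq, hp, hq⟩ := Int.exists_gcd_one h
    obtain ⟨x, t, hxt⟩ := Int.isCoprime_iff_gcd_eq_one.2 hpq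
    refine ⟨q', x, -p', t, by linear_combination hxt, ?_⟩
    linear_combination q' * hp - p' * hq

/-- Two Euclidean steps: `D` is the product of a unimodular 2×2 block in coordinates 0, 1, which
clears entry 0 of the row `n`, and one in coordinates 1, 2, which clears entry 1. -/
theorem exists_vecMul_eq_zero (n : Fin 3 → ℤ) :
    ∃ D : SL(3, ℤ), Matrix.vecMul n D.1 0 = 0 ∧ Matrix.vecMul n D.1 1 = 0 := by
  obtain ⟨s, x, y, t, hdet, h0⟩ := exists_unimodular_pair (n 0) (n 1)
  obtain ⟨s', x', y', t', hdet', h1⟩ := exists_unimodular_pair (n 0 * x + n 1 * t) (n 2)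
  refine ⟨⟨!![s, x * s', x * x'; y, t * s', t * x'; 0, y', t'], ?_⟩, ?_, ?_⟩
  · rw [Matrix.det_fin_three]
    simp
    linear_combination (s' * t' - x' * y') * hdet + hdet'
  · simp [Matrix.vecMul, dotProduct, Fin.sum_univ_three]
    linear_combination h0
  · simp [Matrix.vecMul, dotProduct, Fin.sum_univ_three]
    linear_combination h1

theorem exists_int_dotProduct_eq_zero (v w : Fin 3 → ℚ) :
    ∃ n : Fin 3 → ℤ, n ≠ 0 ∧ ∑ i, v i * n i = 0 ∧ ∑ i, w i * n i = 0 := by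
  -- The zero third row makes the matrix singular whether or not `v` and `w` are independent; a
  -- kernel vector is then scaled to be integral.
  have hdet : (Matrix.of ![v, w, 0]).det = 0 := Matrix.det_eq_zero_of_row_eq_zero 2 (by simp)
  obtain ⟨n, hn, h⟩ := Matrix.exists_mulVec_eq_zero_iff.2 hdet
  obtain ⟨⟨N, hN⟩, hint⟩ := IsLocalization.exist_integer_multiples_of_finite (nonZeroDivisors ℤ) n
  have hN0 : (N : ℚ) ≠ 0 := by exact_mod_cast nonZeroDivisors.ne_zero hN
  choose m hm using hint
  have hm' : ∀ i, (m i : ℚ) = N * n i := fun i => by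
    have := hm i
    simpa [Algebra.smul_def] using this
  refine ⟨m, ?_, ?_, ?_⟩
  · rintro rfl
    apply hn
    ext i
    have := hm' i
    simpa [hN0] using this.symm
  · have : ∑ i, v i * n i = 0 := congrFun h 0
    simp only [hm']
    calc _ = N * ∑ i, v i * n i := by
          rw [Finset.mul_sum]
          exact Finset.sum_congr rfl fun i _ => by ring
      _ = 0 := by rw [this, mul_zero]
  · have : ∑ i, w i * n i = 0 := congrFun h 1
    simp only [hm']
    calc _ = N * ∑ i, w i * n i := by
          rw [Finset.mul_sum]
          exact Finset.sum_congr rfl fun i _ => by ring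
      _ = 0 := by rw [this, mul_zero]

end unimodular

/-! ### Normal form of doubly irrational edges -/

section frame

/-- The plane of vectors whose third coordinate is `0`. -/
def stdPlane : Submodule ℚ (Fin 3 → ℚ) := LinearMap.ker (LinearMap.proj 2)

theorem mem_stdPlane (v : Fin 3 → ℚ) : v ∈ stdPlane ↔ v 2 = 0 := Iff.rfl

theorem finrank_stdPlane : Module.finrank ℚ stdPlane = 2 := by
  have h := LinearMap.finrank_range_add_finrank_ker (LinearMap.proj 2 : (Fin 3 → ℚ) →ₗ[ℚ] ℚ)
  rw [LinearMap.range_eq_top.2 (LinearMap.proj_surjective 2), finrank_top] at h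
  rw [Module.finrank_self, Module.finrank_fin_fun] at h
  exact Nat.add_left_cancel (h : 1 + _ = 1 + 2)

variable {E : Type*} [Field E] [CharZero E]

theorem mem_extend_stdPlane (v : Fin 3 → E) : v ∈ extend E stdPlane ↔ v 2 = 0 := by
  constructor
  · intro h
    induction h using Submodule.span_induction with
    | mem x hx =>
      obtain ⟨y, hy, rfl⟩ := hx
      have : y 2 = 0 := hy
      simp [incl, this]
    | zero => rfl
    | add x y _ _ hx hy => simp [hx, hy]
    | smul c x _ hx => simp [hx]
  · intro h
    have : v = v 0 • incl E ![1, 0, 0] + v 1 • incl E ![0, 1, 0] := by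
      ext i
      fin_cases i <;> simp [incl, h]
    rw [this]
    refine Submodule.add_mem _ (Submodule.smul_mem _ _ ?_) (Submodule.smul_mem _ _ ?_) <;>
    · rw [incl_mem_extend_iff, mem_stdPlane]
      simp

theorem mem_irrationalVertices_of_span {V : TitsVertex E} {β : E}
    (hβ : β ∉ Set.range (Rat.cast : ℚ → E)) (hV : V.1 = Submodule.span E {![β, 1, 0]}) :
    V ∈ irrationalVertices E := by
  rintro ⟨W, rfl⟩
  obtain ⟨w, hw, hw0⟩ := Submodule.exists_mem_ne_zero_of_ne_bot W.2.1
  have h1 := (incl_mem_extend_iff E W.1 w).2 hw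
  rw [show extend E W.1 = _ from hV] at h1
  obtain ⟨c, hc⟩ := Submodule.mem_span_singleton.1 h1
  have e0 := congrFun hc 0
  have e1 := congrFun hc 1
  have e2 := congrFun hc 2
  simp [incl] at e0 e1 e2
  have hw1 : w 1 ≠ 0 := by
    intro h
    rw [h, Rat.cast_zero] at e1
    rw [e1, zero_mul] at e0
    apply hw0
    ext i
    fin_cases i
    · exact_mod_cast e0.symm
    · exact h
    · simpa using e2.symm
  have hw1' : (w 1 : E) ≠ 0 := by exact_mod_cast hw1
  refine hβ ⟨w 0 / w 1, ?_⟩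
  push_cast
  rw [← e0, ← e1]
  rw [← e1] at hw1'
  field_simp

/-- In the standard plane, a point whose second coordinate is 0 is spanned by (1, 0, 0), and one
with rational slope is rational too; both are excluded. -/
theorem exists_span_eq {V : TitsVertex E} (hV : V ∈ irrationalVertices E)
    (h1 : Module.finrank E V.1 = 1) (hle : ∀ x ∈ V.1, x 2 = 0) :
    ∃ β : E, β ∉ Set.range (Rat.cast : ℚ → E) ∧ V.1 = Submodule.span E {![β, 1, 0]} := by
  obtain ⟨b, hb, hb0⟩ := Submodule.exists_mem_ne_zero_of_ne_bot V.2.1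
  have hVb : V.1 = Submodule.span E {b} := by
    refine (Submodule.eq_of_le_of_finrank_eq ?_ ?_).symm
    · simpa using hb
    · rw [finrank_span_singleton hb0, h1]
  have hb2 := hle b hb
  have hb1 : b 1 ≠ 0 := by
    intro hb1
    have hbb : b = b 0 • incl E ![1, 0, 0] := by
      ext i
      fin_cases i <;> simp [incl, hb1, hb2]
    have hb00 : b 0 ≠ 0 := fun h => hb0 (by rw [hbb, h, zero_smul])
    apply irrationalVertices_of_extend E hV (Submodule.span ℚ {![1, 0, 0]})
    rw [extend_span_singleton, hVb, hbb]
    exact Submodule.span_singleton_smul_eq (IsUnit.mk0 _ hb00) _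
  have hbb : b = b 1 • ![b 0 / b 1, 1, 0] := by
    ext i
    fin_cases i <;> simp [hb2]
    field_simp
  have hV' : V.1 = Submodule.span E {![b 0 / b 1, 1, 0]} := by
    rw [hVb, hbb, Submodule.span_singleton_smul_eq (IsUnit.mk0 _ hb1)]
    simp [hb1]
  refine ⟨b 0 / b 1, ?_, hV'⟩
  rintro ⟨r, hr⟩
  apply irrationalVertices_of_extend E hV (Submodule.span ℚ {![r, 1, 0]})
  rw [extend_span_singleton, hV', ← hr]
  congr 2
  ext i
  fin_cases i <;> simp [incl]

theorem exists_span_sup_span_eq (hE : Module.finrank ℚ E = 2) (e : irrationalEdges E)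
    (hle : ∀ x ∈ e.1.1.1.1, x 2 = 0) :
    ∃ (β : E) (a : Fin 3 → ℤ), β ∉ Set.range (Rat.cast : ℚ → E) ∧ a 2 ≠ 0 ∧
      e.1.1.1.1 = Submodule.span E {![β, 1, 0]} ∧
      e.1.1.2.1 = Submodule.span E {![β, 1, 0]} ⊔ Submodule.span E {intVec E a} := by
  have hdim := titsEdge_finrank e.1.2
  obtain ⟨β, hβ, hV⟩ := exists_span_eq e.2.1 hdim.1 hle
  have hVL : e.1.1.1.1 < e.1.1.2.1 := e.1.2
  obtain ⟨y, hy, hy2⟩ : ∃ y ∈ e.1.1.2.1, y 2 ≠ 0 := by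
    by_contra! h
    refine irrationalVertices_of_extend E e.2.2 stdPlane
      (Submodule.eq_of_le_of_finrank_eq (fun x hx => (mem_extend_stdPlane x).2 (h x hx)) ?_)
    rw [hdim.2, finrank_extend, finrank_stdPlane]
  -- A rational point of the plane is sought as y / y₂ - t(β, 1, 0). With t = y₁ / y₂ + q it equals
  -- (p, -q, 1); `a` is this vector with denominators cleared.
  obtain ⟨p, q, hpq⟩ := exists_eq_add_mul hE hβ (y 0 / y 2 - β * (y 1 / y 2))
  have hb : ![β, 1, 0] ∈ e.1.1.1.1 := by
    rw [hV]
    exact Submodule.mem_span_singleton_self _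
  have hp : (p.den : E) ≠ 0 := by exact_mod_cast p.den_nz
  have hq : (q.den : E) ≠ 0 := by exact_mod_cast q.den_nz
  let a : Fin 3 → ℤ := ![p.num * q.den, -(q.num * p.den), p.den * q.den]
  have ha2 : a 2 ≠ 0 := by
    simp [a]
  have haL : intVec E a ∈ e.1.1.2.1 := by
    have : intVec E a = ((p.den : E) * q.den) •
        ((y 2)⁻¹ • y - (y 1 / y 2 + q) • ![β, 1, 0]) := by
      have hp' : (p : E) = p.num / p.den := Rat.cast_def p
      have hq' : (q : E) = q.num / q.den := Rat.cast_def q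
      ext i
      fin_cases i
      · have : (y 2)⁻¹ * y 0 - (y 1 / y 2 + q) * β = p := by
          linear_combination hpq
        simp only [intVec, a, Fin.zero_eta, Pi.smul_apply, Pi.sub_apply, smul_eq_mul,
          Matrix.cons_val_zero, this]
        rw [hp']
        push_cast
        field_simp
      · change ((-(q.num * p.den) : ℤ) : E) =
          ((p.den : E) * q.den) * ((y 2)⁻¹ * y 1 - (y 1 / y 2 + q) * 1)
        rw [hq']
        push_cast
        field_simp
        ring
      · change ((p.den * q.den : ℤ) : E) =
          ((p.den : E) * q.den) * ((y 2)⁻¹ * y 2 - (y 1 / y 2 + q) * 0)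
        rw [inv_mul_cancel₀ hy2]
        push_cast
        ring
    rw [this]
    exact Submodule.smul_mem _ _ (Submodule.sub_mem _ (Submodule.smul_mem _ _ hy)
      (Submodule.smul_mem _ _ (hVL.le hb)))
  refine ⟨β, a, hβ, ha2, hV, ?_⟩
  rw [← hV]
  have hlt : e.1.1.1.1 < e.1.1.1.1 ⊔ Submodule.span E {intVec E a} := by
    refine lt_of_le_of_ne le_sup_left fun h => ?_
    have h1 : intVec E a ∈ e.1.1.1.1 := by
      rw [h]
      exact Submodule.mem_sup_right (Submodule.mem_span_singleton_self _)
    have := hle _ h1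
    simp only [intVec] at this
    exact ha2 (by exact_mod_cast this)
  have h3 := Submodule.finrank_lt_finrank_of_lt hlt
  refine (Submodule.eq_of_le_of_finrank_le (sup_le hVL.le (by simpa using haL)) ?_).symm
  have h4 := hdim.1
  have h5 := hdim.2
  omega

/-- Writing b = v + βw with v, w rational puts b in a rational plane, with integral normal n. If nD
= (0, 0, *) with * ≠ 0, then 0 = n·b = (nD)·(D⁻¹b) forces the third coordinate of D⁻¹b to vanish. -/
theorem exists_act_le (hE : Module.finrank ℚ E = 2) (V : TitsVertex E)
    (h1 : Module.finrank E V.1 = 1) : ∃ D : SL(3, ℤ), ∀ x ∈ act E D⁻¹ V.1, x 2 = 0 := by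
  obtain ⟨β, hβ⟩ := exists_notMem_range_cast hE
  obtain ⟨b, hb, hb0⟩ := Submodule.exists_mem_ne_zero_of_ne_bot V.2.1
  have hVb : V.1 = Submodule.span E {b} := by
    refine (Submodule.eq_of_le_of_finrank_eq ?_ ?_).symm
    · simpa using hb
    · rw [finrank_span_singleton hb0, h1]
  choose v w hvw using fun i => exists_eq_add_mul hE hβ (b i)
  obtain ⟨n, hn0, hnv, hnw⟩ := exists_int_dotProduct_eq_zero v w
  obtain ⟨D, hD0, hD1⟩ := exists_vecMul_eq_zero n
  refine ⟨D, ?_⟩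
  rw [hVb, act_span_singleton]
  have hnb : ∑ i, (n i : E) * b i = 0 := by
    have e1 : ∑ i, (v i : E) * n i = 0 := by exact_mod_cast hnv
    have e2 : ∑ i, (w i : E) * n i = 0 := by exact_mod_cast hnw
    calc ∑ i, (n i : E) * b i = ∑ i, (v i : E) * n i + β * ∑ i, (w i : E) * n i := by
          rw [Finset.mul_sum, ← Finset.sum_add_distrib]
          exact Finset.sum_congr rfl fun i _ => by rw [hvw]; ring
      _ = 0 := by rw [e1, e2]; ring
  set y := (toGLK E D⁻¹ : Matrix (Fin 3) (Fin 3) E).mulVec b with hy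
  have hby : b = (toGLK E D : Matrix (Fin 3) (Fin 3) E).mulVec y := by
    rw [hy, ← mulVec_mul, mul_inv_cancel, map_one]
    simp
  have hD2 : Matrix.vecMul n D.1 2 ≠ 0 := by
    intro h2
    apply hn0
    have h : Matrix.vecMul n D.1 = 0 := by
      ext i
      fin_cases i <;> assumption
    exact Matrix.eq_zero_of_vecMul_eq_zero (by rw [D.2]; norm_num) h
  have hsum : ∑ i, (n i : E) * b i = ∑ j, ((Matrix.vecMul n D.1 j : ℤ) : E) * y j := by
    rw [hby]
    simp [toGLK, Matrix.mulVec, Matrix.vecMul, dotProduct, Fin.sum_univ_three]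
    ring
  rw [hnb, Fin.sum_univ_three, hD0, hD1] at hsum
  have hy2 : y 2 = 0 := by
    have : ((Matrix.vecMul n D.1 2 : ℤ) : E) ≠ 0 := by exact_mod_cast hD2
    simpa [this] using hsum.symm
  intro x hx
  obtain ⟨c, rfl⟩ := Submodule.mem_span_singleton.1 hx
  simp [hy2]

/-- Every edge of `T(E³)` with two irrational vertices is an `SL₃(ℤ)`-translate of an edge
`⟨b⟩ < ⟨b, a⟩` with `b = (β, 1, 0)` irrational and `a` integral. -/
theorem exists_frame (hE : Module.finrank ℚ E = 2) (e : irrationalEdges E) :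
    ∃ (D : SL(3, ℤ)) (β : E) (a : Fin 3 → ℤ), β ∉ Set.range (Rat.cast : ℚ → E) ∧ a 2 ≠ 0 ∧
      e.1.1.1.1 = act E D (Submodule.span E {![β, 1, 0]}) ∧
      e.1.1.2.1 = act E D (Submodule.span E {![β, 1, 0]} ⊔ Submodule.span E {intVec E a}) := by
  obtain ⟨D, hD⟩ := exists_act_le hE e.1.1.1 (titsEdge_finrank e.1.2).1
  obtain ⟨β, a, hβ, ha, h1, h2⟩ := exists_span_sup_span_eq hE (D⁻¹ • e) hD
  refine ⟨D, β, a, hβ, ha, ?_, ?_⟩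
  · rw [← h1]
    exact (act_inv_act D⁻¹ e.1.1.1.1).symm.trans (by rw [inv_inv]; rfl)
  · rw [← h2]
    exact (act_inv_act D⁻¹ e.1.1.2.1).symm.trans (by rw [inv_inv]; rfl)

end frame

/-! ### The matrices M(h, u) as the stabilizer of the standard plane -/

section blockMatrix

theorem toGLK_mulVec {K : Type*} [Field K] (g : SL(3, ℤ)) (v : Fin 3 → K) (i : Fin 3) :
    (toGLK K g : Matrix (Fin 3) (Fin 3) K).mulVec v i =
      g.1 i 0 * v 0 + g.1 i 1 * v 1 + g.1 i 2 * v 2 := by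
  simp [toGLK, Matrix.mulVec, dotProduct, Fin.sum_univ_three]

theorem blockMatrix_mem_subspaceStabilizer (h : GL (Fin 2) ℤ) (u : Fin 2 → ℤ) :
    blockMatrix h u ∈ subspaceStabilizer stdPlane := by
  rw [mem_subspaceStabilizer_iff]
  refine Submodule.eq_of_le_of_finrank_eq ?_ (finrank_act _ _)
  rintro _ ⟨v, hv, rfl⟩
  rw [mem_stdPlane]
  have hv2 : v 2 = 0 := hv
  refine (toGLK_mulVec _ v 2).trans ?_
  simp [blockMatrix, hv2]

theorem exists_eq_blockMatrix {g : SL(3, ℤ)} (hg : g ∈ subspaceStabilizer stdPlane) :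
    ∃ (h : GL (Fin 2) ℤ) (u : Fin 2 → ℤ), g = blockMatrix h u := by
  have hz : ∀ v ∈ stdPlane, (toGLK ℚ g : Matrix (Fin 3) (Fin 3) ℚ).mulVec v 2 = 0 := by
    intro v hv
    rw [← mem_stdPlane, ← (mem_subspaceStabilizer_iff g stdPlane).1 hg]
    exact mulVec_mem_act g hv
  have h0 := hz ![1, 0, 0] rfl
  have h1 := hz ![0, 1, 0] rfl
  rw [toGLK_mulVec] at h0 h1
  simp at h0 h1
  have hdet := g.2
  rw [Matrix.det_fin_three, h0, h1] at hdet
  let A : Matrix (Fin 2) (Fin 2) ℤ := !![g.1 0 0, g.1 0 1; g.1 1 0, g.1 1 1]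
  have hA : A.det * g.1 2 2 = 1 := by
    rw [Matrix.det_fin_two_of]
    linear_combination hdet
  have hAu : IsUnit A.det := IsUnit.of_mul_eq_one _ hA
  -- Both are ±1 with product 1, hence equal.
  have h22 : g.1 2 2 = A.det := by
    have := Int.isUnit_mul_self hAu
    linear_combination A.det * hA - g.1 2 2 * this
  refine ⟨Matrix.GeneralLinearGroup.mk'' A hAu, ![g.1 0 2, g.1 1 2], ?_⟩
  apply Subtype.ext
  ext i j
  fin_cases i <;> fin_cases j <;> first | rfl | exact h0 | exact h1 | exact h22

end blockMatrix

/-! ### Conjugate eigenbases and unital matrices -/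

section eigenbasis

variable {E : Type*} [Field E] [CharZero E]

theorem act_span_intVec {g g' : SL(3, ℤ)} {a a' : Fin 3 → ℤ}
    (h : act ℚ g (Submodule.span ℚ {intVec ℚ a}) = act ℚ g' (Submodule.span ℚ {intVec ℚ a'})) :
    act E g (Submodule.span E {intVec E a}) = act E g' (Submodule.span E {intVec E a'}) := by
  have := congrArg (extend E) h
  rwa [extend_act, extend_act, extend_span_singleton, extend_span_singleton, incl_intVec,
    incl_intVec] at this

theorem act_span_intVec_iff {g g' : SL(3, ℤ)} {a a' : Fin 3 → ℤ} :
    act E g (Submodule.span E {intVec E a}) = act E g' (Submodule.span E {intVec E a'}) ↔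
    act ℚ g (Submodule.span ℚ {intVec ℚ a}) = act ℚ g' (Submodule.span ℚ {intVec ℚ a'}) := by
  refine ⟨fun h => ?_, act_span_intVec⟩
  rw [← incl_intVec E a, ← incl_intVec E a', ← extend_span_singleton, ← extend_span_singleton,
    ← extend_act, ← extend_act] at h
  exact le_antisymm ((extend_le_extend_iff E).1 h.le) ((extend_le_extend_iff E).1 h.ge)

/-- The matrix with rows b, b', a has determinant (β - σβ)a₂ ≠ 0. Since `g` has integral entries,
applying σ to the eigenvector equation of b gives that of b'. -/
theorem isConjEigenbasis_of_mem_stabilizer [NumberField E] (hE : Module.finrank ℚ E = 2) {β : E}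
    (hβ : β ∉ Set.range (Rat.cast : ℚ → E)) {a : Fin 3 → ℤ} (ha : a 2 ≠ 0) {g : SL(3, ℤ)}
    (hb : g ∈ subspaceStabilizer (Submodule.span E {![β, 1, 0]}))
    (hga : g ∈ subspaceStabilizer (Submodule.span E {intVec E a})) :
    IsConjEigenbasis g a ![β, 1, 0] := by
  obtain ⟨σ, hσ⟩ := exists_algEquiv_ne_one hE
  refine ⟨σ, hσ, ?_, (isEigen_iff _ _).2 hb, ?_, (isEigen_iff _ _).2 hga⟩
  · refine Matrix.linearIndependent_rows_of_det_ne_zero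
      (A := Matrix.of ![![β, 1, 0], fun i => σ (![β, 1, 0] i), intVec E a]) ?_
    rw [Matrix.det_fin_three]
    simp [intVec]
    rw [← sub_mul, mul_eq_zero, not_or, sub_eq_zero]
    exact ⟨(algEquiv_apply_ne hE hσ hβ).symm, by exact_mod_cast ha⟩
  · obtain ⟨c, hc⟩ := (isEigen_iff _ _).2 hb
    refine ⟨σ c, ?_⟩
    ext i
    have := congrArg σ (congrFun hc i)
    rw [toGLK_mulVec] at this ⊢
    simpa only [map_add, map_mul, map_intCast, Pi.smul_apply, smul_eq_mul] using this

theorem isUnital_of_isEigen {β : E} (hβ : β ∉ Set.range (Rat.cast : ℚ → E)) {h : GL (Fin 2) ℤ}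
    {u : Fin 2 → ℤ} (he : IsEigen (blockMatrix h u) ![β, 1, 0]) : IsUnital E h := by
  obtain ⟨c, hc⟩ := he
  have hc0 : c ≠ 0 := by
    rintro rfl
    rw [zero_smul, mulVec_eq_zero_iff] at hc
    simpa using congrFun hc 1
  refine ⟨β, hβ, Units.mk0 c hc0, ?_⟩
  have e0 := congrFun hc 0
  have e1 := congrFun hc 1
  rw [toGLK_mulVec] at e0 e1
  ext i
  fin_cases i
  · simpa [blockMatrix, Matrix.mulVec, dotProduct, Fin.sum_univ_two] using e0
  · simpa [blockMatrix, Matrix.mulVec, dotProduct, Fin.sum_univ_two] using e1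

/-- Otherwise b, b' and a would all lie in the standard plane and could not span E³. -/
theorem apply_two_ne_zero_of_isConjEigenbasis {g : SL(3, ℤ)} {a : Fin 3 → ℤ} {b : Fin 3 → E}
    (h : IsConjEigenbasis g a b) (hb : b 2 = 0) : a 2 ≠ 0 := by
  obtain ⟨σ, -, hli, -⟩ := h
  intro ha
  have hspan := hli.span_eq_top_of_card_eq_finrank (by simp)
  have hle : Submodule.span E (Set.range ![b, fun i => σ (b i), intVec E a]) ≤
      extend E stdPlane := by
    rw [Submodule.span_le]
    rintro _ ⟨i, rfl⟩
    refine (mem_extend_stdPlane _).2 ?_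
    fin_cases i <;> simp [hb, ha, intVec]
  rw [hspan] at hle
  have := (mem_extend_stdPlane (Pi.single 2 1 : Fin 3 → E)).1 (hle trivial)
  simp at this

/-- If `h` is unital and `M(h, u)` has an eigenbasis `b, b', a` such that `b` does not lie in the
plane of vectors with third coordinate `0`, then `h` is scalar. -/
theorem blockMatrix_mulVec_of_apply_two_ne_zero {h : GL (Fin 2) ℤ} {u : Fin 2 → ℤ}
    (hh : IsUnital E h) {a : Fin 3 → ℤ} {b : Fin 3 → E}
    (hb : IsConjEigenbasis (blockMatrix h u) a b) (hb2 : b 2 ≠ 0) :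
    IsEigen (blockMatrix h u) (intVec ℚ ![1, 0, 0]) := by
  obtain ⟨β, hβ, μ, hμ⟩ := hh
  obtain ⟨σ, -, hli, ⟨c, hc⟩, ⟨c', hc'⟩, ⟨c'', hc''⟩⟩ := hb
  set M := blockMatrix h u with hM
  have hlast : ∀ v : Fin 3 → E, (toGLK E M : Matrix (Fin 3) (Fin 3) E).mulVec v 2 =
      h.1.det * v 2 := by
    intro v
    rw [toGLK_mulVec]
    simp [hM, blockMatrix]
  -- The last row of `M` is (0, 0, det h), so an eigenvector with nonzero third coordinate has
  -- eigenvalue det h. This applies to both b and b'.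
  have e1 : c = h.1.det := by
    have := congrFun hc 2
    rw [hlast, Pi.smul_apply, smul_eq_mul] at this
    exact (mul_right_cancel₀ hb2 this).symm
  have e2 : c' = h.1.det := by
    have := congrFun hc' 2
    rw [hlast, Pi.smul_apply, smul_eq_mul] at this
    exact (mul_right_cancel₀ ((map_ne_zero σ).2 hb2) this).symm
  have hw : (toGLK E M : Matrix (Fin 3) (Fin 3) E).mulVec ![β, 1, 0] = (μ : E) • ![β, 1, 0] := by
    have h0 := congrFun hμ 0
    have h1 := congrFun hμ 1
    simp [Matrix.mulVec, dotProduct, Fin.sum_univ_two] at h0 h1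
    ext i
    rw [toGLK_mulVec]
    fin_cases i
    · simpa [hM, blockMatrix] using h0
    · simpa [hM, blockMatrix] using h1
    · simp [hM, blockMatrix]
  have hspan := hli.span_eq_top_of_card_eq_finrank (by simp)
  have hmem : ![β, 1, 0] ∈ Submodule.span E (Set.range ![b, fun i => σ (b i), intVec E a]) :=
    hspan ▸ Submodule.mem_top
  obtain ⟨x, hx⟩ := (Submodule.mem_span_range_iff_exists_fun E).1 hmem
  simp only [Fin.sum_univ_three, Matrix.cons_val_zero, Matrix.cons_val_one, Matrix.cons_val] at hx
  -- `M - det h` kills b and b', so its image is spanned by a. An irrational vector (β, 1, 0) cannot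
  -- be a multiple of the rational a, which forces μ = det h.
  have hdiff : ((μ : E) - h.1.det) • ![β, 1, 0] = (x 2 * (c'' - h.1.det)) • intVec E a := by
    rw [sub_smul, ← hw, ← hx, Matrix.mulVec_add, Matrix.mulVec_add, Matrix.mulVec_smul,
      Matrix.mulVec_smul, Matrix.mulVec_smul, hc, hc', hc'', e1, e2]
    module
  have hμe : (μ : E) = h.1.det := by
    by_contra hne
    have hne' := sub_ne_zero.2 hne
    have h0 := congrFun hdiff 0
    have h1 := congrFun hdiff 1
    simp [intVec] at h0 h1
    set y := x 2 * (c'' - h.1.det)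
    have ha1 : (a 1 : E) ≠ 0 := by
      intro h
      rw [h, mul_zero] at h1
      exact hne' h1
    apply hβ
    refine ⟨a 0 / a 1, ?_⟩
    push_cast
    rw [div_eq_iff ha1]
    have hy : y ≠ 0 := by
      intro hy
      rw [hy, zero_mul] at h1
      exact hne' h1
    apply mul_left_cancel₀ hy
    linear_combination β * h1 - h0
  have h0 := congrFun hμ 0
  have h1 := congrFun hμ 1
  simp [Matrix.mulVec, dotProduct, Fin.sum_univ_two, hμe] at h0 h1
  -- The second row of h - det h is rational and kills (β, 1), so it is zero; in particular the
  -- lower left entry of h vanishes and (1, 0, 0) is an eigenvector.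
  have h1' := eq_zero_of_add_mul_eq_zero hβ (p := h.1 1 1 - h.1.det) (q := h.1 1 0) (by
    simp only [Rat.cast_sub, Rat.cast_intCast]
    linear_combination h1)
  have h10 : h.1 1 0 = 0 := by exact_mod_cast h1'.2
  refine ⟨h.1 0 0, ?_⟩
  ext i
  rw [toGLK_mulVec]
  fin_cases i <;> simp [hM, blockMatrix, intVec, h10]

end eigenbasis

/-! ### Comparison of the stabilizer symbols with the outputs -/

section outputs

variable (Γ : Subgroup SL(3, ℤ)) (E : Type) [Field E] [CharZero E]

/-- Up to sign the symbol becomes the coboundary of [f, b, a] in St(E³), so it dies in the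
coinvariants there. -/
theorem symbolClass_mem_HSpace {γ : SL(3, ℤ)} (hγ : γ ∈ Γ) {P : Submodule ℚ (Fin 3 → ℚ)}
    (hP : Module.finrank ℚ P = 2) {f a : Fin 3 → ℚ} {b : Fin 3 → E} (hf : f ∈ P) (hf0 : f ≠ 0)
    (ha : a ∉ P) (hb : b ∈ extend E P) (hb0 : b ≠ 0) (hγP : act ℚ γ P = P)
    (hγa : act ℚ γ (Submodule.span ℚ {a}) = Submodule.span ℚ {a})
    (hγb : act E γ (Submodule.span E {b}) = Submodule.span E {b}) :
    symbolClass Γ f ((toGLK ℚ γ : Matrix (Fin 3) (Fin 3) ℚ).mulVec f) a ∈ HSpace Γ E := by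
  rw [symbolClass, H0π_mem_HSpace_iff]
  have h := steinbergRep_sub_eq γ hP hf hf0 ha hb hb0 hγP hγa hγb
  rw [← neg_mem_iff, ← map_neg, h]
  exact Representation.Coinvariants.sub_mem_ker (ρ := steinbergRepOn E Γ) ⟨γ, hγ⟩ _

theorem modularSymbol_smul_eq_zero {K : Type*} [Field K] (c : K) (x z : Fin 3 → K) :
    modularSymbol x (c • x) z = 0 := by
  rw [modularSymbol, dif_neg]
  intro h
  have h2 := (Fintype.linearIndependent_iff.1 h) ![c, -1, 0] (by simp [Fin.sum_univ_three]) 1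
  simp at h2

omit [CharZero E] in
variable {E} in
theorem pow_conj_fixes {M : SL(3, ℤ)} {W : Submodule E (Fin 3 → E)}
    (hM : M ∈ subspaceStabilizer W) (d : SL(3, ℤ)) (k : ℕ) :
    act E ((d * M * d⁻¹) ^ k) (act E d W) = act E d W := by
  rw [conj_pow]
  exact act_conj_of_mem_subspaceStabilizer (Subgroup.pow_mem _ hM k) d

/-- Nothing in the procedure forces b into the standard plane. If it lies there,
`symbolClass_mem_HSpace` applies to the translate by `d`; if not, `e` is an eigenvector of M(h, u),
so `f` and `γ f` are proportional and the symbol is 0. -/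
theorem outputs_subset_HSpace (D : (Fin 3 → ℤ) → (Fin 3 → E) → Set SL(3, ℤ)) :
    outputs Γ E D ⊆ HSpace Γ E := by
  rintro m ⟨h, u, a, b, d, γ, k, f, hh, hb, -, hk, rfl, rfl, rfl⟩
  set M := blockMatrix h u with hM
  rw [← toGLK_mulVec_intVec ((d * M * d⁻¹) ^ k), SetLike.mem_coe]
  by_cases hb2 : b 2 = 0
  · have hb0 : b ≠ 0 := by
      obtain ⟨σ, -, hli, -⟩ := hb
      exact hli.ne_zero 0
    have ha2 := apply_two_ne_zero_of_isConjEigenbasis hb hb2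
    obtain ⟨σ, -, -, hMb, -, hMa⟩ := hb
    rw [isEigen_iff] at hMb hMa
    have hMa' : M ∈ subspaceStabilizer (Submodule.span ℚ {intVec ℚ a}) := by
      have := act_span_intVec_iff (E := E) (g := M) (g' := 1) (a := a) (a' := a)
      rw [act_one, act_one] at this
      exact this.1 hMa
    rw [← toGLK_mulVec_intVec d ![1, 0, 0], ← toGLK_mulVec_intVec d a]
    refine symbolClass_mem_HSpace Γ E hk.1.2 (P := act ℚ d stdPlane)
      (b := (toGLK E d : Matrix (Fin 3) (Fin 3) E).mulVec b)
      ((finrank_act _ _).trans finrank_stdPlane) ?_ ?_ ?_ ?_ ?_ ?_ ?_ ?_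
    · rw [mulVec_mem_act_iff, mem_stdPlane]
      simp [intVec]
    · rw [Ne, mulVec_eq_zero_iff, intVec_eq_zero_iff]
      simp
    · rw [mulVec_mem_act_iff, mem_stdPlane]
      simpa [intVec] using ha2
    · rw [extend_act, mulVec_mem_act_iff, mem_extend_stdPlane]
      exact hb2
    · rwa [Ne, mulVec_eq_zero_iff]
    · exact pow_conj_fixes (blockMatrix_mem_subspaceStabilizer h u) d k
    · rw [← act_span_singleton]
      exact pow_conj_fixes hMa' d k
    · rw [← act_span_singleton]
      exact pow_conj_fixes hMb d k
  · have h1 := blockMatrix_mulVec_of_apply_two_ne_zero hh hb hb2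
    rw [isEigen_iff] at h1
    have h2 := pow_conj_fixes h1 d k
    rw [act_span_singleton, toGLK_mulVec_intVec] at h2
    obtain ⟨c, hc⟩ := (isEigen_iff _ _).2 ((mem_subspaceStabilizer_iff _ _).2 h2)
    rw [symbolClass, hc, modularSymbol_smul_eq_zero, map_zero]
    exact zero_mem _

variable {Γ E}

theorem symbolClass_mem_outputs [NumberField E] (hE : Module.finrank ℚ E = 2)
    {D : (Fin 3 → ℤ) → (Fin 3 → E) → Set SL(3, ℤ)} {β : E}
    (hβ : β ∉ Set.range (Rat.cast : ℚ → E)) {a : Fin 3 → ℤ} (ha : a 2 ≠ 0) {d : SL(3, ℤ)}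
    (hd : d ∈ D a ![β, 1, 0]) {γ : SL(3, ℤ)} (hγ : γ ∈ Γ)
    (hP : act ℚ γ (act ℚ d stdPlane) = act ℚ d stdPlane)
    (hγa : act E γ (act E d (Submodule.span E {intVec E a})) =
      act E d (Submodule.span E {intVec E a}))
    (hγb : act E γ (act E d (Submodule.span E {![β, 1, 0]})) =
      act E d (Submodule.span E {![β, 1, 0]})) :
    symbolClass Γ (intVec ℚ (d.1.mulVec ![1, 0, 0]))
      ((toGLK ℚ γ : Matrix (Fin 3) (Fin 3) ℚ).mulVec (intVec ℚ (d.1.mulVec ![1, 0, 0])))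
      (intVec ℚ (d.1.mulVec a)) ∈ outputs Γ E D := by
  have key : ∀ {K : Type} [Field K] {W : Submodule K (Fin 3 → K)},
      act K γ (act K d W) = act K d W → d⁻¹ * γ * d ∈ subspaceStabilizer W := by
    intro K _ W h
    rw [mem_subspaceStabilizer_iff, act_mul, act_mul, h, act_inv_act]
  obtain ⟨h, u, hM⟩ := exists_eq_blockMatrix (key hP)
  have hγM : d * blockMatrix h u * d⁻¹ = γ := by
    rw [← hM]
    group
  have hMb := key hγb
  have hMa := key hγa
  rw [hM] at hMb hMa
  -- The exponent is 1: the conjugate of `blockMatrix h u` by `d` is `γ`, which already lies in `Γ`.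
  refine ⟨h, u, a, ![β, 1, 0], d, γ, 1, d.1.mulVec ![1, 0, 0],
    isUnital_of_isEigen hβ ((isEigen_iff _ _).2 hMb),
    isConjEigenbasis_of_mem_stabilizer hE hβ ha hMb hMa, hd, ⟨⟨one_pos, ?_⟩, fun j hj => hj.1⟩, ?_,
    rfl, ?_⟩
  · rwa [hγM, pow_one]
  · rw [hγM, pow_one]
  · rw [toGLK_mulVec_intVec]

variable (Γ) in
/-- Every edge `⟨b⟩ < ⟨b, a⟩` of `T(E³)` with two irrational vertices can be moved by `Γ` to an edge
`⟨d b⟩ < ⟨d b, d a⟩` with `b` in the standard plane and `d ∈ D(a, b)`. -/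
def MeetsOrbits (D : (Fin 3 → ℤ) → (Fin 3 → E) → Set SL(3, ℤ)) : Prop :=
  ∀ (d₀ : SL(3, ℤ)) (β₀ : E) (a₀ : Fin 3 → ℤ), β₀ ∉ Set.range (Rat.cast : ℚ → E) → a₀ 2 ≠ 0 →
    ∃ g ∈ Γ, ∃ (β : E) (a : Fin 3 → ℤ), β ∉ Set.range (Rat.cast : ℚ → E) ∧ a 2 ≠ 0 ∧
      ∃ d ∈ D a ![β, 1, 0],
        act E (g * d₀) (Submodule.span E {![β₀, 1, 0]}) = act E d (Submodule.span E {![β, 1, 0]}) ∧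
        act E (g * d₀) (Submodule.span E {intVec E a₀}) = act E d (Submodule.span E {intVec E a})

/-- The rational plane through an irrational point is unique, so whatever fixes the point fixes the
plane. The next lemma is the dual. -/
theorem vertexAct_eq_of_irrational_left {e : irrationalEdges E} {γ : SL(3, ℤ)} (hγ : γ • e = e)
    {W : TitsVertex ℚ} (hW : e.1.1.1 ≤ extendVertex E W) :
    vertexAct (toGLK ℚ γ) W = W := by
  have h1 : vertexAct (toGLK E γ) e.1.1.1 = e.1.1.1 :=
    congrArg (fun x : irrationalEdges E => x.1.1.1) hγ
  have hlt : e.1.1.1 < extendVertex E W := lt_of_le_of_ne hW fun h => e.2.1 ⟨W, h.symm⟩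
  refine eq_of_irrational_lt E e.2.1 ?_ hlt
  rw [extendVertex_vertexAct]
  have := vertexAct_strictMono (toGLK E γ) hlt
  rwa [h1] at this

theorem vertexAct_eq_of_irrational_right {e : irrationalEdges E} {γ : SL(3, ℤ)} (hγ : γ • e = e)
    {W : TitsVertex ℚ} (hW : extendVertex E W ≤ e.1.1.2) :
    vertexAct (toGLK ℚ γ) W = W := by
  have h1 : vertexAct (toGLK E γ) e.1.1.2 = e.1.1.2 :=
    congrArg (fun x : irrationalEdges E => x.1.1.2) hγ
  have hlt : extendVertex E W < e.1.1.2 := lt_of_le_of_ne hW fun h => e.2.2 ⟨W, h⟩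
  refine eq_of_lt_irrational E e.2.2 ?_ hlt
  rw [extendVertex_vertexAct]
  have := vertexAct_strictMono (toGLK E γ) hlt
  rwa [h1] at this

/-- This is the lifting hypothesis of `mem_of_mem_coinvariants_ker`: the lift is the apartment [f,
b, a] of a `Γ`-translate of the edge, chosen so that `d` is an allowed choice. -/
theorem exists_lift [NumberField E] (hE : Module.finrank ℚ E = 2)
    {D : (Fin 3 → ℤ) → (Fin 3 → E) → Set SL(3, ℤ)} (hD : MeetsOrbits Γ D) (e : irrationalEdges E) :
    ∃ g : Γ, ∃ m : Steinberg E, irrationalPart E m = Finsupp.single ((g : SL(3, ℤ)) • e) 1 ∧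
      ∀ γ : Γ, (γ : SL(3, ℤ)) • (g : SL(3, ℤ)) • e = (g : SL(3, ℤ)) • e →
        ∃ t : Steinberg ℚ, groupHomology.H0π (Rep.of (steinbergRepOn ℚ Γ)) t ∈
          Submodule.span ℚ (outputs Γ E D) ∧
          steinbergIncl E t = steinbergRepOn E Γ γ m - m := by
  obtain ⟨d₀, β₀, a₀, hβ₀, ha₀, hV₀, hL₀⟩ := exists_frame hE e
  obtain ⟨g, hg, β, a, hβ, ha, d, hd, hb', ha'⟩ := hD d₀ β₀ a₀ hβ₀ ha₀
  have hV : (g • e).1.1.1.1 = act E d (Submodule.span E {![β, 1, 0]}) := by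
    rw [← hb', act_mul, ← hV₀]
    rfl
  have hL : (g • e).1.1.2.1 = act E d (Submodule.span E {![β, 1, 0]}) ⊔
      act E d (Submodule.span E {intVec E a}) := by
    rw [← hb', ← ha', ← act_sup, act_mul, ← hL₀]
    rfl
  have hP : Module.finrank ℚ (act ℚ d stdPlane) = 2 := (finrank_act _ _).trans finrank_stdPlane
  have hf : intVec ℚ (d.1.mulVec ![1, 0, 0]) ∈ act ℚ d stdPlane := by
    rw [← toGLK_mulVec_intVec, mulVec_mem_act_iff, mem_stdPlane]
    simp [intVec]
  have hf0 : intVec ℚ (d.1.mulVec ![1, 0, 0]) ≠ 0 := by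
    rw [← toGLK_mulVec_intVec, Ne, mulVec_eq_zero_iff, intVec_eq_zero_iff]
    simp
  have haP : intVec ℚ (d.1.mulVec a) ∉ act ℚ d stdPlane := by
    rw [← toGLK_mulVec_intVec, mulVec_mem_act_iff, mem_stdPlane]
    simpa [intVec] using ha
  have haP0 : intVec ℚ (d.1.mulVec a) ≠ 0 := fun h => haP (h ▸ Submodule.zero_mem _)
  have hbP : (toGLK E d : Matrix (Fin 3) (Fin 3) E).mulVec ![β, 1, 0] ∈
      extend E (act ℚ d stdPlane) := by
    rw [extend_act, mulVec_mem_act_iff, mem_extend_stdPlane]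
    rfl
  have hb0 : (toGLK E d : Matrix (Fin 3) (Fin 3) E).mulVec ![β, 1, 0] ≠ 0 := by
    rw [Ne, mulVec_eq_zero_iff]
    intro h
    simpa using congrFun h 1
  have hspan : act E d (Submodule.span E {intVec E a}) =
      extend E (Submodule.span ℚ {intVec ℚ (d.1.mulVec a)}) := by
    rw [extend_span_singleton, incl_intVec, act_span_singleton, toGLK_mulVec_intVec]
  refine ⟨⟨g, hg⟩, _, irrationalPart_modularSymbol hP hf hf0 haP hbP hb0 (g • e) ?_ ?_, ?_⟩
  · rw [hV, act_span_singleton]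
  · rw [hL, hspan, act_span_singleton, extend_span_singleton]
  · rintro ⟨γ, hγ⟩ hfix
    have hγb : act E γ (act E d (Submodule.span E {![β, 1, 0]})) =
        act E d (Submodule.span E {![β, 1, 0]}) := by
      rw [← hV]
      exact congrArg (fun x : irrationalEdges E => x.1.1.1.1) hfix
    let W : TitsVertex ℚ := ⟨act ℚ d stdPlane, by
      intro h
      rw [h, finrank_bot] at hP
      omega, fun h => haP (h ▸ Submodule.mem_top)⟩
    have hγP : act ℚ γ (act ℚ d stdPlane) = act ℚ d stdPlane := by
      refine congrArg Subtype.val (vertexAct_eq_of_irrational_left (W := W) hfix ?_)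
      change (g • e).1.1.1.1 ≤ extend E (act ℚ d stdPlane)
      rw [hV, act_span_singleton]
      simpa using hbP
    let A : TitsVertex ℚ := ⟨Submodule.span ℚ {intVec ℚ (d.1.mulVec a)}, by simpa using haP0, by
      intro h
      have := finrank_span_singleton (K := ℚ) haP0
      rw [h, finrank_top, Module.finrank_fin_fun] at this
      omega⟩
    have hγa : act ℚ γ (Submodule.span ℚ {intVec ℚ (d.1.mulVec a)}) =
        Submodule.span ℚ {intVec ℚ (d.1.mulVec a)} := by
      refine congrArg Subtype.val (vertexAct_eq_of_irrational_right (W := A) hfix ?_)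
      change extend E (Submodule.span ℚ {intVec ℚ (d.1.mulVec a)}) ≤ (g • e).1.1.2.1
      rw [hL, hspan]
      exact le_sup_right
    refine ⟨_, ?_, steinbergRep_sub_eq γ hP hf hf0 haP hbP hb0 hγP hγa ?_⟩
    · rw [map_neg, neg_mem_iff]
      refine Submodule.subset_span (symbolClass_mem_outputs hE hβ ha hd hγ hγP ?_ hγb)
      rw [hspan, ← extend_act, hγa]
    · rw [← act_span_singleton]
      exact hγb

theorem HSpace_eq_span_outputs [NumberField E] (hE : Module.finrank ℚ E = 2)
    {D : (Fin 3 → ℤ) → (Fin 3 → E) → Set SL(3, ℤ)} (hD : MeetsOrbits Γ D) :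
    HSpace Γ E = Submodule.span ℚ (outputs Γ E D) := by
  refine le_antisymm ?_ (Submodule.span_le.2 (outputs_subset_HSpace Γ E D))
  intro y hy
  induction y using groupHomology.H0_induction_on with
  | h z =>
  have hz := (H0π_mem_HSpace_iff Γ E z).1 hy
  refine mem_of_mem_coinvariants_ker (X := irrationalEdges E) (steinbergRepOn E Γ)
    (steinbergRepOn ℚ Γ) (steinbergIncl E) (steinbergIncl_injective E) (steinbergIncl_comm E Γ)
    (irrationalPart E) (ker_irrationalPart E)
    (fun g m => irrationalPart_steinbergRep (g : SL(3, ℤ)) m)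
    -- The submodule `T` is the preimage in St(ℚ³) of the span of the outputs; `Γ` acts trivially
    -- modulo it because it contains the kernel of the map to coinvariants.
    ((Submodule.span ℚ (outputs Γ E D)).comap
      (groupHomology.H0π (Rep.of (steinbergRepOn ℚ Γ))).hom) ?_ (exists_lift hE hD) z hz
  intro g n
  have h0 := (H0π_eq_zero_iff (Rep.of (steinbergRepOn ℚ Γ)) _).2
    (Representation.Coinvariants.sub_mem_ker (ρ := steinbergRepOn ℚ Γ) g n)
  rw [Submodule.mem_comap]
  exact h0 ▸ Submodule.zero_mem _

end outputs

/-! ### Admissible restrictions on d -/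

section representatives

variable {Γ : Subgroup SL(3, ℤ)} {E : Type} [Field E] [CharZero E]

omit [CharZero E] in
theorem meetsOrbits_univ : MeetsOrbits Γ (fun _ (_ : Fin 3 → E) => Set.univ) := by
  intro d₀ β₀ a₀ hβ₀ ha₀
  exact ⟨1, one_mem _, β₀, a₀, hβ₀, ha₀, d₀, trivial, by rw [one_mul], by rw [one_mul]⟩

/-- With d₀ = x d s, the factor s fixes the lines of a and b, so the same pair (a, b) serves for d.
-/
theorem meetsOrbits_of_pairStabilizer_reps {D : (Fin 3 → ℤ) → (Fin 3 → E) → Set SL(3, ℤ)}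
    (hD : ∀ a b, IsDoubleCosetReps Γ (pairStabilizer a b) (D a b)) : MeetsOrbits Γ D := by
  intro d₀ β₀ a₀ hβ₀ ha₀
  obtain ⟨d, ⟨hd, hd₀⟩, -⟩ := hD a₀ ![β₀, 1, 0] d₀
  obtain ⟨x, hx, s, hs, rfl⟩ := DoubleCoset.mem_doubleCoset.1 hd₀
  refine ⟨x⁻¹, inv_mem hx, β₀, a₀, hβ₀, ha₀, d, hd, ?_, ?_⟩
  · rw [mul_assoc x, inv_mul_cancel_left, act_mul, (mem_subspaceStabilizer_iff _ _).1 hs.2]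
  · rw [mul_assoc x, inv_mul_cancel_left, act_span_intVec_iff, act_mul,
      (mem_subspaceStabilizer_iff _ _).1 hs.1]

/-- Here s only preserves the standard plane, so the pair is replaced by (sa, sb). The point sb is
still irrational in that plane, hence again spanned by some (β, 1, 0), and sa stays outside the
plane. -/
theorem meetsOrbits_of_P3_reps {R : Set SL(3, ℤ)} (hR : IsDoubleCosetReps Γ P3 R) :
    MeetsOrbits Γ (fun _ (_ : Fin 3 → E) => R) := by
  intro d₀ β₀ a₀ hβ₀ ha₀
  obtain ⟨d, ⟨hd, hd₀⟩, -⟩ := hR d₀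
  obtain ⟨x, hx, s, hs, rfl⟩ := DoubleCoset.mem_doubleCoset.1 hd₀
  have hs' : act ℚ s stdPlane = stdPlane := hs
  have hb0 : (![β₀, 1, 0] : Fin 3 → E) ≠ 0 := fun h => by simp at h
  let V : TitsVertex E := ⟨Submodule.span E {![β₀, 1, 0]}, by simp, by
    intro h
    have := finrank_span_singleton (K := E) hb0
    rw [h, finrank_top, Module.finrank_fin_fun] at this
    omega⟩
  obtain ⟨β, hβ, hV⟩ := exists_span_eq
    (vertexAct_mem_irrationalVertices s (mem_irrationalVertices_of_span (V := V) hβ₀ rfl))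
    ((finrank_act s V.1).trans (finrank_span_singleton hb0)) (by
      intro y hy
      rw [← mem_extend_stdPlane, ← hs', extend_act]
      refine Submodule.map_mono ?_ hy
      change Submodule.span E _ ≤ _
      rw [Submodule.span_singleton_le_iff_mem, mem_extend_stdPlane]
      rfl)
  refine ⟨x⁻¹, inv_mem hx, β, s.1.mulVec a₀, hβ, ?_, d, hd, ?_, ?_⟩
  · intro h
    have h1 : intVec ℚ (s.1.mulVec a₀) ∈ stdPlane := by
      rw [mem_stdPlane]
      simp [intVec, h]
    rw [← hs', ← toGLK_mulVec_intVec, mulVec_mem_act_iff, mem_stdPlane] at h1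
    exact ha₀ (by simpa [intVec] using h1)
  · rw [mul_assoc x, inv_mul_cancel_left, act_mul, ← hV]
    rfl
  · rw [mul_assoc x, inv_mul_cancel_left, act_mul, act_span_singleton s, toGLK_mulVec_intVec]

end representatives

end
end RealQuadraticSteinberg

theorem mainTheorem2 (E : Type) [Field E] [NumberField E] [NumberField.IsTotallyReal E]
    (hE : Module.finrank ℚ E = 2) (Γ : Subgroup SL(3, ℤ)) [Γ.FiniteIndex] :
    (∀ D : (Fin 3 → ℤ) → (Fin 3 → E) → Set SL(3, ℤ),
      (∀ a b, RealQuadraticSteinberg.IsDoubleCosetReps Γ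
        (RealQuadraticSteinberg.pairStabilizer a b) (D a b)) →
      RealQuadraticSteinberg.HSpace Γ E =
        Submodule.span ℚ (RealQuadraticSteinberg.outputs Γ E D)) ∧
    RealQuadraticSteinberg.HSpace Γ E =
      Submodule.span ℚ (RealQuadraticSteinberg.outputs Γ E fun _ _ => Set.univ) ∧
    (∀ R : Set SL(3, ℤ),
      RealQuadraticSteinberg.IsDoubleCosetReps Γ RealQuadraticSteinberg.P3 R →
      RealQuadraticSteinberg.HSpace Γ E =
        Submodule.span ℚ (RealQuadraticSteinberg.outputs Γ E fun _ _ => R)) :=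
  ⟨fun _ hD => RealQuadraticSteinberg.HSpace_eq_span_outputs hE
      (RealQuadraticSteinberg.meetsOrbits_of_pairStabilizer_reps hD),
    RealQuadraticSteinberg.HSpace_eq_span_outputs hE RealQuadraticSteinberg.meetsOrbits_univ,
    fun _ hR => RealQuadraticSteinberg.HSpace_eq_span_outputs hE
      (RealQuadraticSteinberg.meetsOrbits_of_P3_reps hR)⟩
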